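/- Let $E_D>0$, $v_F>0$ and $\vartheta_\sharp\in\mathbb R\setminus\{0\}$ be constants. Let $\kappa:\mathbb R^2\to\mathbb R$ belong to $C_b^\infty(\mathbb R^2)$, i.e. $\kappa$ is smooth and $\kappa$ and each of its derivatives are bounded, and let $\alpha_{10},\alpha_{20}\in\mathcal S(\mathbb R^2)$ be complex-valued Schwartz functions. Consider for $\boldsymbol\alpha=(\alpha_1,\alpha_2)^T:\mathbb R^2\times[0,\infty)\to\mathbb C^2$ the Dirac equation with varying mass $$ \begin{aligned} i\partial_T\alpha_1-\frac{v_F}{2\sqrt{E_D}}\,(i\partial_{X_1}-\partial_{X_2})\alpha_2+\frac{\vartheta_\sharp\,\kappa(\boldsymbol X)}{2\sqrt{E_D}}\,\alpha_1&=0,\\ i\partial_T\alpha_2-\frac{v_F}{2\sqrt{E_D}}\,(i\partial_{X_1}+\partial_{X_2})\alpha_1-\frac{\vartheta_\sharp\,\kappa(\boldsymbol X)}{2\sqrt{E_D}}\,\alpha_2&=0, \end{aligned} $$ with the initial condition $\alpha_1(\boldsymbol X,0)=\alpha_{10}(\boldsymbol X)$, $\alpha_2(\boldsymbol X,0)=\alpha_{20}(\boldsymbol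 X)$. This problem has a solution $\boldsymbol\alpha\in C^\infty([0,\infty)\times\mathbb R^2)$. It is unique, even among $C^1$ solutions: for $I=[0,\infty)$ and for $I=[0,\rho]$ with any $0<\rho<\infty$, every solution of class $C^1(I\times\mathbb R^2)$ coincides with $\boldsymbol\alpha$ on $I\times\mathbb R^2$. Moreover: 1. for all $0<\rho<\infty$ and all real $s>2$, $$\boldsymbol\alpha\in C^0\big([0,\rho],H^s(\mathbb R^2)\big)\cap C^1\big([0,\rho],H^{s-1}(\mathbb R^2)\big);$$ 2. for all $T\ge0$, $l\in\mathbb N=\{0,1,2,\dots\}$ and $j\in\{1,2\}$, $\partial_T^l\alpha_j(\cdot,T)\in\mathcal S(\mathbb R^2)$; 3. for all $0<\rho<\infty$, $l,M\in\mathbb N$ and $\mathbf n\in\mathbb N^2$ there is a constant $C>0$ such that $$\sup_{T\in[0,\rho],\ \boldsymbol X\in\mathbb R^2}\Big|(1+|\boldsymbol X|^2)^{M/2}\,\partial_{\boldsymbol X}^{\mathbf n}\partial_T^l\boldsymbol\alpha(\boldsymbol X,T)\Big|\le C.$$ -/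

import Mathlib

open Set MeasureTheory
open scoped SchwartzMap ContDiff ENNReal

noncomputable section

/-- The spatial domain `ℝ²`, with the Euclidean norm. -/
abbrev Plane : Type := EuclideanSpace ℝ (Fin 2)

/-- The space `ℂ²` of spinors `(α₁, α₂)`; the components are indexed by `0` and `1`. -/
abbrev Spinor : Type := EuclideanSpace ℂ (Fin 2)

/-- `C_b^∞(ℝ²)`, real valued: smooth functions that are bounded together with all derivatives. -/
def IsSmoothBounded (κ : Plane → ℝ) : Prop :=
  ContDiff ℝ ∞ κ ∧ ∀ k : ℕ, ∃ C : ℝ, ∀ X : Plane, ‖iteratedFDeriv ℝ k κ X‖ ≤ C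

/-- The classical partial derivative `∂_{X_j} f` of a function on the plane
(`j = 0, 1` stands for `X₁, X₂`). -/
def spacePartial {V : Type*} [NormedAddCommGroup V] [NormedSpace ℝ V]
    (j : Fin 2) (f : Plane → V) : Plane → V :=
  fun X => lineDeriv ℝ f X (EuclideanSpace.single j 1)

/-- The multi-index derivative `∂_X^n f = ∂_{X₁}^{n₁} ∂_{X₂}^{n₂} f`. -/
def spacePartials {V : Type*} [NormedAddCommGroup V] [NormedSpace ℝ V]
    (n : Fin 2 → ℕ) (f : Plane → V) : Plane → V :=
  (spacePartial 0)^[n 0] ((spacePartial 1)^[n 1] f)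

/-- `α ∈ C^k(I × ℝ²)`, where `α T X` is the value at time `T ∈ I` and position `X`. -/
def IsClassCk (k : WithTop ℕ∞) (I : Set ℝ) (α : ℝ → Plane → Spinor) : Prop :=
  ContDiffOn ℝ k (fun p : ℝ × Plane => α p.1 p.2) (I ×ˢ univ)

/-- `α` satisfies, at all times `T ∈ I`, the Dirac system with mass `κ`
`i ∂_T α₁ - v/(2√E) (i ∂_{X₁} - ∂_{X₂}) α₂ + ϑ κ/(2√E) α₁ = 0`,
`i ∂_T α₂ - v/(2√E) (i ∂_{X₁} + ∂_{X₂}) α₁ - ϑ κ/(2√E) α₂ = 0`,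
and it takes the initial values `α₁ = α₁₀`, `α₂ = α₂₀` at `T = 0`. Time derivatives are taken within
`I`, so that they are one-sided at the end points of `I`. -/
structure SolvesDirac (E v ϑ : ℝ) (κ : Plane → ℝ) (α₁₀ α₂₀ : Plane → ℂ) (I : Set ℝ)
    (α : ℝ → Plane → Spinor) : Prop where
  eq_one : ∀ T ∈ I, ∀ X : Plane,
    Complex.I * derivWithin (fun t => α t X 0) I T
      - ((v / (2 * √E) : ℝ) : ℂ) *
          (Complex.I * spacePartial 0 (fun Y => α T Y 1) X - spacePartial 1 (fun Y => α T Y 1) X)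
      + ((ϑ * κ X / (2 * √E) : ℝ) : ℂ) * α T X 0 = 0
  eq_two : ∀ T ∈ I, ∀ X : Plane,
    Complex.I * derivWithin (fun t => α t X 1) I T
      - ((v / (2 * √E) : ℝ) : ℂ) *
          (Complex.I * spacePartial 0 (fun Y => α T Y 0) X + spacePartial 1 (fun Y => α T Y 0) X)
      - ((ϑ * κ X / (2 * √E) : ℝ) : ℂ) * α T X 1 = 0
  init_one : ∀ X : Plane, α 0 X 0 = α₁₀ X
  init_two : ∀ X : Plane, α 0 X 1 = α₂₀ X

/-- `α ∈ C^k(I, H^s(ℝ²))`, for `s ≥ 0`. The space `H^s` is the Bessel potential space: it consists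
of the `f ∈ L²` for which the Bessel potential `⟨D⟩^s f` is in `L²`, and `f ↦ ⟨D⟩^s f` identifies
`H^s` with `L²` isometrically. Hence the curve `T ↦ α T` is `C^k` into `H^s` exactly if
`T ↦ ⟨D⟩^s (α T)` is a `C^k` curve in `L²`. -/
def IsSobolevCurve (k : WithTop ℕ∞) (s : ℝ) (I : Set ℝ) (α : ℝ → Plane → Spinor) : Prop :=
  ∃ U : ℝ → Lp Spinor 2 (volume : Measure Plane), ContDiffOn ℝ k U I ∧
    ∀ T ∈ I, ∃ h : MemLp (α T) 2 (volume : Measure Plane),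
      TemperedDistribution.besselPotential Plane Spinor s
        (Lp.toTemperedDistribution (h.toLp (α T))) = Lp.toTemperedDistribution (U T)

end

noncomputable section

open scoped LineDeriv FourierTransform Laplacian

/-! ### Abstract convergence theorem: stable and consistent one-step schemes. -/

section Scheme

/-! In vector form the system reads α' = G α with G = c (σ₁ ∂₁ - σ₂ ∂₂) + i m κ σ₃, c = v/(2√E), m =
ϑ/(2√E): a symmetric hyperbolic system with a bounded skew-adjoint potential.

Existence is proved directly in the Schwartz space by operator splitting. The matrices `pauliOne`
and `pauliTwo` are Hermitian involutions, so the group generated by c A ∂_j translates the two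
spectral components of A along opposite directions; the potential is advanced by an Euler step. The
product S h of these three steps has two properties. Stability: in each weighted Sobolev norm one
step costs a factor exp(C h) in the same norm, so the iterates stay bounded up to a fixed time.
Consistency: S h = 1 + h G + O(h²), where the error may be measured by a stronger seminorm; this
loss of derivatives and decay is harmless because the data are Schwartz. By Sobolev embedding the
weighted norms generate the Schwartz topology (`sobDominated_of_continuous`), so both properties
hold for all continuous seminorms.

Telescoping then makes the approximations with steps 2⁻ⁿ converge geometrically
(`IsConsistent.exists_solution`), and the limit satisfies α(T') = α(T) + (T' - T) G α(T) + O((T' -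
T)²). Solving for -G as well and gluing at time 0 gives a curve γ on the whole line with (Q γ)' = Q
(G γ) for every continuous linear Q into a normed space (`exists_solutionCurve`). The regularity
claims follow by choosing Q: point evaluation after differential operators gives joint smoothness
and ∂_T^l γ = G^l γ; weighted derivatives in the sup norm give the uniform bounds; Bessel potentials
into L² give the Sobolev curves.

Uniqueness is a local energy argument (`eq_zero_of_solution`): for the difference of two C¹
solutions, the integral of its squared norm against a smooth cutoff of a backward cone is
nonincreasing and starts at 0. No decay at infinity is needed. -/

lemma Seminorm.sub_le_sum {V : Type*} [AddCommGroup V] [Module ℝ V] (q : Seminorm ℝ V) (u : ℕ → V) (n : ℕ) :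
    q (u n - u 0) ≤ ∑ j ∈ Finset.range n, q (u (j + 1) - u j) := by
  rw [← Finset.sum_range_sub]
  induction n with
  | zero => simp
  | succ n ih =>
    rw [Finset.sum_range_succ, Finset.sum_range_succ]
    exact (map_add_le_add q _ _).trans (by gcongr)


variable {V : Type*} [AddCommGroup V] [Module ℝ V] [TopologicalSpace V]

/-- The one-step operators `S h` agree with `1 + h A` up to second order in `h`. -/
def IsConsistent (S : ℝ → Module.End ℝ V) (A : V →L[ℝ] V) : Prop :=
  ∀ q : Seminorm ℝ V, Continuous q → ∃ q' : Seminorm ℝ V, Continuous q' ∧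
    ∀ h ∈ Icc (0 : ℝ) 1, ∀ g, q (S h g - g - h • A g) ≤ h ^ 2 * q' g

/-- The iterates of the one-step operators `S h` are bounded up to any fixed time. -/
def IsStable (S : ℝ → Module.End ℝ V) : Prop :=
  ∀ q : Seminorm ℝ V, Continuous q → ∀ ρ : ℝ, ∃ q' : Seminorm ℝ V, Continuous q' ∧
    ∀ h ∈ Icc (0 : ℝ) 1, ∀ m : ℕ, m * h ≤ ρ → ∀ g, q ((S h ^ m) g) ≤ q' g

lemma Seminorm.continuous_add {p q : Seminorm ℝ V} (hp : Continuous p) (hq : Continuous q) :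
    Continuous (p + q : Seminorm ℝ V) := by
  rw [FunLike.coe_add]; exact hp.add hq

lemma Seminorm.continuous_clm_comp {p : Seminorm ℝ V} (hp : Continuous p) (A : V →L[ℝ] V) :
    Continuous (p.comp (A : V →ₗ[ℝ] V)) := by
  rw [Seminorm.coe_comp]; exact hp.comp A.continuous

lemma IsConsistent.sub_le {S : ℝ → Module.End ℝ V} {A : V →L[ℝ] V} (hS : IsConsistent S A)
    {q : Seminorm ℝ V} (hq : Continuous q) : ∃ q' : Seminorm ℝ V, Continuous q' ∧
      ∀ h ∈ Icc (0 : ℝ) 1, ∀ g, q (S h g - g) ≤ h * q' g := by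
  obtain ⟨q', hq', H⟩ := hS q hq
  refine ⟨q' + q.comp (A : V →ₗ[ℝ] V), Seminorm.continuous_add hq' (Seminorm.continuous_clm_comp hq A), ?_⟩
  intro h hh g
  have h1 := H h hh g
  have h2 : q (S h g - g) ≤ q (S h g - g - h • A g) + q (h • A g) := by
    simpa using map_add_le_add q (S h g - g - h • A g) (h • A g)
  rw [map_smul_eq_mul, Real.norm_of_nonneg hh.1] at h2
  have h3 : h ^ 2 * q' g ≤ h * q' g := by
    have := hh.1; have := hh.2
    gcongr
    · nlinarith
  simp only [add_apply, Seminorm.comp_apply, ContinuousLinearMap.coe_coe]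
  linarith

/-- The error of S₂ is carried through S₁, hence the stability of S₁; the cross term h (S₁ - 1) A₂
is of second order because S₁ - 1 = O(h). -/
lemma IsConsistent.comp [IsTopologicalAddGroup V] {S₁ S₂ : ℝ → Module.End ℝ V} {A₁ A₂ : V →L[ℝ] V}
    (h₁ : IsConsistent S₁ A₁) (h₂ : IsConsistent S₂ A₂) (hst : IsStable S₁) :
    IsConsistent (fun h => S₁ h * S₂ h) (A₁ + A₂) := by
  intro q hq
  obtain ⟨q₁, hq₁, H₁⟩ := h₁ q hq
  obtain ⟨q₂, hq₂, H₂⟩ := hst q hq 1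
  obtain ⟨q₃, hq₃, H₃⟩ := h₂ q₂ hq₂
  obtain ⟨q₄, hq₄, H₄⟩ := h₁.sub_le hq
  refine ⟨q₃ + q₁ + q₄.comp (A₂ : V →ₗ[ℝ] V), Seminorm.continuous_add (Seminorm.continuous_add hq₃ hq₁)
    (Seminorm.continuous_clm_comp hq₄ A₂), fun h hh g => ?_⟩
  have e : (S₁ h * S₂ h) g - g - h • (A₁ + A₂) g =
      S₁ h (S₂ h g - g - h • A₂ g) + (S₁ h g - g - h • A₁ g) + h • (S₁ h (A₂ g) - A₂ g) := by
    simp only [Module.End.mul_apply, map_sub, map_smul, add_apply, smul_add,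
      smul_sub]
    abel
  have b1 := H₂ h hh 1 (by simpa using hh.2) (S₂ h g - g - h • A₂ g)
  rw [pow_one] at b1
  have b2 := H₃ h hh g
  have b3 := H₁ h hh g
  have b4 := mul_le_mul_of_nonneg_left (H₄ h hh (A₂ g)) hh.1
  have b5 : q (h • (S₁ h (A₂ g) - A₂ g)) = h * q (S₁ h (A₂ g) - A₂ g) := by
    rw [map_smul_eq_mul, Real.norm_of_nonneg hh.1]
  rw [e]
  have t1 := map_add_le_add q (S₁ h (S₂ h g - g - h • A₂ g) + (S₁ h g - g - h • A₁ g))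
    (h • (S₁ h (A₂ g) - A₂ g))
  have t2 := map_add_le_add q (S₁ h (S₂ h g - g - h • A₂ g)) (S₁ h g - g - h • A₁ g)
  simp only [add_apply, Seminorm.comp_apply, ContinuousLinearMap.coe_coe]
  nlinarith

variable {S : ℝ → Module.End ℝ V} {A : V →L[ℝ] V}

/-- Halving the step changes a single step to second order only. -/
lemma IsConsistent.halving (hS : IsConsistent S A) (hst : IsStable S) {q : Seminorm ℝ V}
    (hq : Continuous q) : ∃ q' : Seminorm ℝ V, Continuous q' ∧
      ∀ h ∈ Icc (0 : ℝ) (1 / 2), ∀ g, q (S (2 * h) g - S h (S h g)) ≤ h ^ 2 * q' g := by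
  obtain ⟨q₁, hq₁, H₁⟩ := hS q hq
  obtain ⟨q₂, hq₂, H₂⟩ := hst q₁ hq₁ 1
  obtain ⟨q₃, hq₃, H₃⟩ := hS.sub_le (Seminorm.continuous_clm_comp hq A)
  refine ⟨((4 : NNReal) • q₁) + q₁ + q₂ + q₃, ?_, fun h hh g => ?_⟩
  · refine Seminorm.continuous_add (Seminorm.continuous_add (Seminorm.continuous_add ?_ hq₁) hq₂) hq₃
    rw [FunLike.coe_smul]; exact hq₁.const_smul _
  have hh1 : h ∈ Icc (0 : ℝ) 1 := ⟨hh.1, by linarith [hh.2]⟩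
  -- The first order terms 2 h A g cancel, leaving three consistency errors and h A (S h - 1) g.
  have e : S (2 * h) g - S h (S h g) =
      (S (2 * h) g - g - (2 * h) • A g) - (S h (S h g) - S h g - h • A (S h g))
        - (S h g - g - h • A g) - h • A (S h g - g) := by
    simp only [map_sub, smul_sub, two_mul, add_smul]
    abel
  have b1 := H₁ (2 * h) ⟨by linarith [hh.1], by linarith [hh.2]⟩ g
  have b2 := H₁ h hh1 (S h g)
  have b2' := H₂ h hh1 1 (by simpa using hh1.2) g
  rw [pow_one] at b2'
  have b3 := H₁ h hh1 g
  have b4 := mul_le_mul_of_nonneg_left (H₃ h hh1 g) hh.1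
  have b5 : q (h • A (S h g - g)) = h * q (A (S h g - g)) := by
    rw [map_smul_eq_mul, Real.norm_of_nonneg hh.1]
  simp only [Seminorm.comp_apply, ContinuousLinearMap.coe_coe] at b4
  rw [e]
  have t1 := map_sub_le_add q (S (2 * h) g - g - (2 * h) • A g - (S h (S h g) - S h g - h • A (S h g))
        - (S h g - g - h • A g)) (h • A (S h g - g))
  have t2 := map_sub_le_add q (S (2 * h) g - g - (2 * h) • A g - (S h (S h g) - S h g - h • A (S h g)))
        (S h g - g - h • A g)
  have t3 := map_sub_le_add q (S (2 * h) g - g - (2 * h) • A g) (S h (S h g) - S h g - h • A (S h g))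
  simp only [add_apply, smul_apply, NNReal.smul_def, smul_eq_mul, NNReal.coe_ofNat]
  nlinarith [sq_nonneg h]

/-- Halving the step changes the approximation at a fixed time to first order in the step. -/
lemma IsConsistent.pow_halving (hS : IsConsistent S A) (hst : IsStable S) {q : Seminorm ℝ V}
    (hq : Continuous q) (ρ : ℝ) (f : V) : ∃ C : ℝ, 0 ≤ C ∧
      ∀ h ∈ Icc (0 : ℝ) (1 / 2), ∀ m : ℕ, m * (2 * h) ≤ ρ →
        q ((S (2 * h) ^ m) f - (S h ^ (2 * m)) f) ≤ C * h := by
  obtain ⟨q₁, hq₁, H₁⟩ := hst q hq ρ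
  obtain ⟨q₂, hq₂, H₂⟩ := hS.halving hst hq₁
  obtain ⟨q₃, hq₃, H₃⟩ := hst q₂ hq₂ ρ
  refine ⟨|ρ| * q₃ f, by positivity, fun h hh m hm => ?_⟩
  have hh1 : h ∈ Icc (0 : ℝ) 1 := ⟨hh.1, by linarith [hh.2]⟩
  have hh2 : 2 * h ∈ Icc (0 : ℝ) 1 := ⟨by linarith [hh.1], by linarith [hh.2]⟩
  -- Interpolates between the two schemes: j coarse steps, then fine ones. Consecutive terms differ
  -- by one halving error propagated by stable iterates, and m errors of size h² add up to O(h).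
  let u : ℕ → V := fun j => (S h ^ (2 * (m - j))) ((S (2 * h) ^ j) f)
  have key := q.sub_le_sum u m
  have h0 : u m - u 0 = (S (2 * h) ^ m) f - (S h ^ (2 * m)) f := by simp [u]
  rw [h0] at key
  refine key.trans ?_
  have step : ∀ j ∈ Finset.range m, q (u (j + 1) - u j) ≤ h ^ 2 * q₃ f := by
    intro j hj
    rw [Finset.mem_range] at hj
    have hjm : (j : ℝ) + 1 ≤ m := by exact_mod_cast hj
    have e : u (j + 1) - u j = (S h ^ (2 * (m - (j + 1))))
        (S (2 * h) ((S (2 * h) ^ j) f) - S h (S h ((S (2 * h) ^ j) f))) := by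
      have e1 : 2 * (m - j) = 2 * (m - (j + 1)) + 2 := by omega
      simp only [u, e1, map_sub, pow_succ' (S (2 * h)), pow_add, Module.End.mul_apply, pow_two]
    rw [e]
    refine (H₁ h hh1 _ ?_ _).trans ((H₂ h hh _).trans ?_)
    · refine le_trans ?_ hm
      have : ((2 * (m - (j + 1)) : ℕ) : ℝ) ≤ 2 * m := by exact_mod_cast (by omega)
      nlinarith [hh.1]
    · gcongr
      refine H₃ _ hh2 j (le_trans ?_ hm) f
      have := hh2.1
      gcongr
  refine (Finset.sum_le_sum step).trans ?_
  rw [Finset.sum_const, Finset.card_range, nsmul_eq_mul]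
  have h3 : 0 ≤ q₃ f := apply_nonneg _ _
  have h4 : (m : ℝ) * h ≤ |ρ| := by
    have : 0 ≤ (m : ℝ) * h := mul_nonneg (by positivity) hh.1
    linarith [le_abs_self ρ]
  nlinarith [mul_le_mul_of_nonneg_right h4 (mul_nonneg hh.1 h3)]

/-- On a grid of step `h`, the approximation follows the equation up to second order. -/
lemma IsConsistent.grid (hS : IsConsistent S A) (hst : IsStable S) {q : Seminorm ℝ V}
    (hq : Continuous q) (ρ : ℝ) (f : V) : ∃ C : ℝ, 0 ≤ C ∧
      ∀ h ∈ Icc (0 : ℝ) 1, ∀ m k : ℕ, (m + k : ℕ) * h ≤ ρ →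
        q ((S h ^ (m + k)) f - (S h ^ m) f - (k * h) • A ((S h ^ m) f)) ≤
          C * ((k * h) * (k * h) + (k * h) * h) := by
  obtain ⟨q₁, hq₁, H₁⟩ := hS q hq
  obtain ⟨q₂, hq₂, H₂⟩ := hst q₁ hq₁ ρ
  obtain ⟨q₃, hq₃, H₃⟩ := hS.sub_le (Seminorm.continuous_clm_comp hq A)
  obtain ⟨q₄, hq₄, H₄⟩ := hst q₃ hq₃ ρ
  have n2 : 0 ≤ q₂ f := apply_nonneg _ _
  have n4 : 0 ≤ q₄ f := apply_nonneg _ _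
  refine ⟨q₂ f + q₄ f, by positivity, fun h hh m k hmk => ?_⟩
  have hh0 := hh.1
  have lip : ∀ j ≤ k, q (A ((S h ^ (m + j)) f - (S h ^ m) f)) ≤ j * (h * q₄ f) := by
    intro j hj
    have := (q.comp (A : V →ₗ[ℝ] V)).sub_le_sum (fun i => (S h ^ (m + i)) f) j
    refine this.trans ?_
    have hstep : ∀ i ∈ Finset.range j, (q.comp (A : V →ₗ[ℝ] V))
        ((S h ^ (m + (i + 1))) f - (S h ^ (m + i)) f) ≤ h * q₄ f := by
      intro i hi
      rw [Finset.mem_range] at hi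
      rw [← add_assoc, pow_succ', Module.End.mul_apply]
      refine (H₃ h hh _).trans ?_
      gcongr
      refine H₄ h hh _ (le_trans ?_ hmk) f
      gcongr
      omega
    refine (Finset.sum_le_sum hstep).trans ?_
    simp
  -- With the linear prediction subtracted, each increment is a consistency error plus h times the
  -- drift of A along the grid, which `lip` bounds.
  let u : ℕ → V := fun j => (S h ^ (m + j)) f - (j * h) • A ((S h ^ m) f)
  have key := q.sub_le_sum u k
  have h0 : u k - u 0 = (S h ^ (m + k)) f - (S h ^ m) f - (k * h) • A ((S h ^ m) f) := by
    simp only [u]; simp; abel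
  rw [h0] at key
  refine key.trans ?_
  have step : ∀ j ∈ Finset.range k, q (u (j + 1) - u j) ≤ h ^ 2 * q₂ f + h * (k * (h * q₄ f)) := by
    intro j hj
    rw [Finset.mem_range] at hj
    set g := (S h ^ (m + j)) f with hg
    have e : u (j + 1) - u j = (S h g - g - h • A g) + h • A (g - (S h ^ m) f) := by
      simp only [u, ← add_assoc, pow_succ', Module.End.mul_apply, ← hg]
      push_cast
      rw [map_sub, smul_sub, add_mul, add_smul, one_mul]
      abel
    rw [e]
    refine (map_add_le_add q _ _).trans ?_
    rw [map_smul_eq_mul, Real.norm_of_nonneg hh0]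
    gcongr
    · refine (H₁ h hh g).trans ?_
      gcongr
      refine H₂ h hh _ (le_trans ?_ hmk) f
      gcongr
    · refine (lip j hj.le).trans ?_
      gcongr
  refine (Finset.sum_le_sum step).trans ?_
  rw [Finset.sum_const, Finset.card_range, nsmul_eq_mul]
  have k0 : (0 : ℝ) ≤ k := by positivity
  have m1 : 0 ≤ (k * h) * (k * h) * q₂ f := by positivity
  have m2 : 0 ≤ (k * h) * h * q₄ f := by positivity
  nlinarith

/-- The approximation at time `T` with step `2⁻ⁿ`, starting from `f`. -/
def dyadicApprox (S : ℝ → Module.End ℝ V) (f : V) (n : ℕ) (T : ℝ) : V :=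
  (S ((1 / 2) ^ n) ^ ⌊T * 2 ^ n⌋₊) f

lemma half_pow_mem (n : ℕ) : (1 / 2 : ℝ) ^ n ∈ Icc (0 : ℝ) 1 :=
  ⟨by positivity, pow_le_one₀ (by norm_num) (by norm_num)⟩

lemma floor_mul_half_pow_le {T ρ : ℝ} (hT : T ≤ ρ) (hρ : 0 ≤ ρ) (n : ℕ) :
    (⌊T * 2 ^ n⌋₊ : ℝ) * (1 / 2) ^ n ≤ ρ := by
  rw [one_div, inv_pow, ← div_eq_mul_inv, div_le_iff₀ (by positivity)]
  refine Nat.cast_le.2 (Nat.floor_le_floor (mul_le_mul_of_nonneg_right hT ?_)) |>.trans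
    (Nat.floor_le (by positivity))
  positivity

/-- Halving the step doubles the number of steps up to one extra fine step, which
`IsConsistent.dyadicApprox_succ` absorbs with a first order bound. -/
lemma floor_two_mul_pow (T : ℝ) (n : ℕ) :
    ⌊T * 2 ^ (n + 1)⌋₊ = 2 * ⌊T * 2 ^ n⌋₊ ∨ ⌊T * 2 ^ (n + 1)⌋₊ = 2 * ⌊T * 2 ^ n⌋₊ + 1 := by
  rcases le_or_gt 0 T with hT | hT
  · have e : T * 2 ^ (n + 1) = 2 * (T * 2 ^ n) := by ring
    have h0 : 0 ≤ T * 2 ^ n := by positivity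
    rw [e]
    have h1 := Nat.floor_le h0
    have h2 := Nat.lt_floor_add_one (T * 2 ^ n)
    have h3 : 2 * ⌊T * 2 ^ n⌋₊ ≤ ⌊2 * (T * 2 ^ n)⌋₊ := Nat.le_floor (by push_cast; linarith)
    have h4 : ⌊2 * (T * 2 ^ n)⌋₊ < 2 * ⌊T * 2 ^ n⌋₊ + 2 :=
      (Nat.floor_lt (by positivity)).2 (by push_cast; linarith)
    omega
  · left
    rw [Nat.floor_of_nonpos, Nat.floor_of_nonpos]
    · exact mul_nonpos_of_nonpos_of_nonneg hT.le (by positivity)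
    · exact mul_nonpos_of_nonpos_of_nonneg hT.le (by positivity)

lemma IsConsistent.dyadicApprox_succ (hS : IsConsistent S A) (hst : IsStable S)
    {q : Seminorm ℝ V} (hq : Continuous q) {ρ : ℝ} (hρ : 0 ≤ ρ) (f : V) :
    ∃ C : ℝ, 0 ≤ C ∧ ∀ n : ℕ, ∀ T ≤ ρ,
      q (dyadicApprox S f (n + 1) T - dyadicApprox S f n T) ≤ C * (1 / 2) ^ n := by
  obtain ⟨C, hC, H⟩ := hS.pow_halving hst hq ρ f
  obtain ⟨q₁, hq₁, H₁⟩ := hS.sub_le hq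
  obtain ⟨q₂, hq₂, H₂⟩ := hst q₁ hq₁ ρ
  have n2 : 0 ≤ q₂ f := apply_nonneg _ _
  refine ⟨C + q₂ f, by positivity, fun n T hT => ?_⟩
  set h : ℝ := (1 / 2) ^ (n + 1) with hh
  have h2 : (1 / 2 : ℝ) ^ n = 2 * h := by rw [hh]; ring
  have hmem : h ∈ Icc (0 : ℝ) 1 := half_pow_mem _
  have hmem' : h ∈ Icc (0 : ℝ) (1 / 2) := ⟨hmem.1, by
    have := (half_pow_mem n).2
    rw [h2] at this; linarith⟩
  have hm := floor_mul_half_pow_le hT hρ n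
  rw [h2] at hm
  have b1 := H h hmem' _ hm
  have hh0 := hmem.1
  have b1' : q ((S h ^ (2 * ⌊T * 2 ^ n⌋₊)) f - (S (2 * h) ^ ⌊T * 2 ^ n⌋₊) f) ≤ C * h := by
    rwa [map_sub_rev]
  unfold dyadicApprox
  rw [← hh, h2]
  rcases floor_two_mul_pow T n with e | e <;> rw [e]
  · nlinarith [mul_nonneg hC hh0, mul_nonneg n2 hh0]
  · rw [pow_succ', Module.End.mul_apply]
    set g := (S h ^ (2 * ⌊T * 2 ^ n⌋₊)) f with hg
    have b2 := H₁ h hmem g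
    have b3 : q₁ g ≤ q₂ f := H₂ h hmem _ (by push_cast; linarith) f
    have t := map_add_le_add q (S h g - g) (g - (S (2 * h) ^ ⌊T * 2 ^ n⌋₊) f)
    rw [sub_add_sub_cancel] at t
    nlinarith [mul_nonneg hC hh0, mul_nonneg n2 hh0, mul_le_mul_of_nonneg_left b3 hh0]

lemma tendsto_floor_mul_half_pow {T : ℝ} (hT : 0 ≤ T) :
    Filter.Tendsto (fun n : ℕ => (⌊T * 2 ^ n⌋₊ : ℝ) * (1 / 2) ^ n) Filter.atTop (nhds T) := by
  have h := (tendsto_nat_floor_mul_div_atTop hT).comp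
    (tendsto_pow_atTop_atTop_of_one_lt (one_lt_two : (1 : ℝ) < 2))
  refine h.congr fun n => ?_
  simp [div_eq_mul_inv]

/-- A stable and consistent scheme converges to a solution of `α' = A α`. -/
theorem IsConsistent.exists_solution [IsTopologicalAddGroup V] [ContinuousSMul ℝ V] [T2Space V]
    (hS : IsConsistent S A) (hst : IsStable S)
    (hV : ∀ u : ℕ → V, (∀ q : Seminorm ℝ V, Continuous q → Summable fun n => q (u n)) →
      ∃ a, Filter.Tendsto (fun n => ∑ i ∈ Finset.range n, u i) Filter.atTop (nhds a)) (f : V) :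
    ∃ α : ℝ → V, α 0 = f ∧
      ∀ q : Seminorm ℝ V, Continuous q → ∀ ρ, 0 ≤ ρ → ∃ C : ℝ, 0 ≤ C ∧
        ∀ T T', 0 ≤ T → T ≤ T' → T' ≤ ρ →
          q (α T' - α T - (T' - T) • A (α T)) ≤ C * (T' - T) ^ 2 := by
  have conv : ∀ T, ∃ a, Filter.Tendsto (fun n => dyadicApprox S f n T) Filter.atTop (nhds a) := by
    intro T
    obtain ⟨a, ha⟩ := hV (fun n => dyadicApprox S f (n + 1) T - dyadicApprox S f n T) (by
      intro q hq
      -- For negative T the number of steps is zero, so the horizon |T| serves for every real T.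
      obtain ⟨C, -, H⟩ := hS.dyadicApprox_succ hst hq (abs_nonneg T) f
      refine Summable.of_nonneg_of_le (fun n => apply_nonneg _ _) (fun n => H n T (le_abs_self T)) ?_
      exact (summable_geometric_of_lt_one (by norm_num) (by norm_num)).mul_left C)
    refine ⟨a + dyadicApprox S f 0 T, ?_⟩
    have := ha.add_const (dyadicApprox S f 0 T)
    refine this.congr fun n => ?_
    rw [Finset.sum_range_sub (fun n => dyadicApprox S f n T)]
    abel
  choose α hα using conv
  refine ⟨α, ?_, fun q hq ρ hρ => ?_⟩
  · refine tendsto_nhds_unique (hα 0) ?_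
    refine tendsto_const_nhds.congr fun n => ?_
    simp [dyadicApprox]
  obtain ⟨C, hC, H⟩ := hS.grid hst hq ρ f
  refine ⟨C, hC, fun T T' hT hTT' hT' => ?_⟩
  have hT'0 := hT.trans hTT'
  let d : ℕ → ℝ := fun n => ((⌊T' * 2 ^ n⌋₊ - ⌊T * 2 ^ n⌋₊ : ℕ) : ℝ) * (1 / 2) ^ n
  have hle : ∀ n, ⌊T * 2 ^ n⌋₊ ≤ ⌊T' * 2 ^ n⌋₊ := fun n =>
    Nat.floor_le_floor (mul_le_mul_of_nonneg_right hTT' (by positivity))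
  have hd : Filter.Tendsto d Filter.atTop (nhds (T' - T)) := by
    refine ((tendsto_floor_mul_half_pow hT'0).sub (tendsto_floor_mul_half_pow hT)).congr fun n => ?_
    simp only [d]
    rw [Nat.cast_sub (hle n), sub_mul]
  have hhalf : Filter.Tendsto (fun n : ℕ => (1 / 2 : ℝ) ^ n) Filter.atTop (nhds 0) :=
    tendsto_pow_atTop_nhds_zero_of_lt_one (by norm_num) (by norm_num)
  have lhs : Filter.Tendsto (fun n => q (dyadicApprox S f n T' - dyadicApprox S f n T
      - d n • A (dyadicApprox S f n T))) Filter.atTop (nhds (q (α T' - α T - (T' - T) • A (α T)))) :=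
    (hq.tendsto _).comp (((hα T').sub (hα T)).sub
      (hd.smul ((A.continuous.tendsto _).comp (hα T))))
  have rhs : Filter.Tendsto (fun n => C * (d n * d n + d n * (1 / 2) ^ n)) Filter.atTop
      (nhds (C * ((T' - T) * (T' - T) + (T' - T) * 0))) :=
    ((hd.mul hd).add (hd.mul hhalf)).const_mul C
  -- The grid estimate passes to the limit; its extra term, proportional to the step, disappears.
  have := le_of_tendsto_of_tendsto' lhs rhs fun n => by
    have e : ⌊T * 2 ^ n⌋₊ + (⌊T' * 2 ^ n⌋₊ - ⌊T * 2 ^ n⌋₊) = ⌊T' * 2 ^ n⌋₊ := by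
      have := hle n; omega
    have := H ((1 / 2) ^ n) (half_pow_mem n) ⌊T * 2 ^ n⌋₊ (⌊T' * 2 ^ n⌋₊ - ⌊T * 2 ^ n⌋₊) (by
      rw [e]; exact floor_mul_half_pow_le hT' hρ n)
    rw [e] at this
    exact this
  calc _ ≤ _ := this
    _ = _ := by ring

end Scheme

/-! ### Completeness of the Schwartz space along absolutely convergent series. -/

section Series

variable {E F : Type*} [NormedAddCommGroup E] [NormedSpace ℝ E] [NormedAddCommGroup F]
  [NormedSpace ℝ F]

lemma SchwartzMap.continuous_seminorm (k n : ℕ) :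
    Continuous (SchwartzMap.seminorm ℝ k n : Seminorm ℝ 𝓢(E, F)) :=
  (schwartz_withSeminorms ℝ E F).continuous_seminorm (k, n)

variable [CompleteSpace F]

/-- The pointwise sum of a series of Schwartz functions that converges absolutely in every
seminorm. -/
lemma SchwartzMap.exists_tsum (u : ℕ → 𝓢(E, F))
    (hu : ∀ k n : ℕ, Summable fun i => SchwartzMap.seminorm ℝ k n (u i)) :
    ∃ a : 𝓢(E, F), (∀ x, HasSum (fun i => u i x) (a x)) ∧
      ∀ k n, SchwartzMap.seminorm ℝ k n a ≤ ∑' i, SchwartzMap.seminorm ℝ k n (u i) := by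
  have hb : ∀ (n : ℕ) (i : ℕ) (x : E), (n : ℕ∞) ≤ (⊤ : ℕ∞) →
      ‖iteratedFDeriv ℝ n (u i) x‖ ≤ SchwartzMap.seminorm ℝ 0 n (u i) := fun n i x _ => by
    simpa using SchwartzMap.le_seminorm ℝ 0 n (u i) x
  have hs : ∀ i, ContDiff ℝ ((⊤ : ℕ∞) : WithTop ℕ∞) (u i) := fun i => (u i).smooth ⊤
  have hdecay : ∀ (k n : ℕ) (x : E), ‖x‖ ^ k * ‖iteratedFDeriv ℝ n (fun y => ∑' i, u i y) x‖ ≤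
      ∑' i, SchwartzMap.seminorm ℝ k n (u i) := by
    intro k n x
    rw [iteratedFDeriv_tsum_apply (N := ⊤) hs (fun n _ => hu 0 n) hb (k := n) le_top x]
    have hsum : Summable fun i => ‖iteratedFDeriv ℝ n (u i) x‖ :=
      Summable.of_nonneg_of_le (fun _ => norm_nonneg _) (fun i => hb n i x le_top) (hu 0 n)
    calc _ ≤ ‖x‖ ^ k * ∑' i, ‖iteratedFDeriv ℝ n (u i) x‖ := by
          gcongr; exact norm_tsum_le_tsum_norm hsum
      _ = ∑' i, ‖x‖ ^ k * ‖iteratedFDeriv ℝ n (u i) x‖ := tsum_mul_left.symm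
      _ ≤ _ := (hsum.mul_left _).tsum_le_tsum (fun i => SchwartzMap.le_seminorm ℝ k n (u i) x) (hu k n)
  refine ⟨⟨fun y => ∑' i, u i y, contDiff_tsum hs (fun n _ => hu 0 n) hb, fun k n => ⟨_, hdecay k n⟩⟩,
    fun x => ?_, fun k n => ?_⟩
  · refine Summable.hasSum (Summable.of_norm_bounded (hu 0 0) fun i => ?_)
    simpa using SchwartzMap.le_seminorm ℝ 0 0 (u i) x
  · exact SchwartzMap.seminorm_le_bound ℝ k n _ (tsum_nonneg fun _ => apply_nonneg _ _) (hdecay k n)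

lemma SchwartzMap.exists_tendsto_sum (u : ℕ → 𝓢(E, F))
    (hu : ∀ q : Seminorm ℝ 𝓢(E, F), Continuous q → Summable fun i => q (u i)) :
    ∃ a, Filter.Tendsto (fun n => ∑ i ∈ Finset.range n, u i) Filter.atTop (nhds a) := by
  have hu' := fun k n => hu _ (SchwartzMap.continuous_seminorm k n)
  obtain ⟨a, ha, -⟩ := SchwartzMap.exists_tsum u hu'
  refine ⟨a, ((schwartz_withSeminorms ℝ E F).tendsto_nhds _ _).2 fun ⟨k, n⟩ ε hε => ?_⟩
  have htail := tendsto_sum_nat_add fun i => SchwartzMap.seminorm ℝ k n (u i)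
  filter_upwards [htail.eventually (gt_mem_nhds hε)] with N hN
  refine lt_of_le_of_lt ?_ hN
  -- The remainder is itself the sum of the shifted series, so its seminorm is at most the tail of a
  -- convergent numerical series.
  obtain ⟨b, hb, hb'⟩ := SchwartzMap.exists_tsum (fun i => u (i + N))
    fun k n => (summable_nat_add_iff N).2 (hu' k n)
  have e : ∑ i ∈ Finset.range N, u i - a = -b := by
    ext x
    have h1 := (hasSum_nat_add_iff' N).2 (ha x)
    have h2 := h1.unique (hb x)
    simp only [sub_apply, neg_apply, ← h2]
    rw [neg_sub]
    simp
  rw [schwartzSeminormFamily_apply, e, map_neg_eq_map]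
  exact hb' k n

end Series

/-! ### Weighted Sobolev norms on Schwartz spinors. -/

section Weighted

/-- The coordinate vector field on the plane. -/
abbrev planeVec (j : Fin 2) : Plane := EuclideanSpace.single j 1

/-- The coordinate derivative `∂_j` on Schwartz spinors. -/
abbrev planeDeriv (j : Fin 2) : 𝓢(Plane, Spinor) →L[ℝ] 𝓢(Plane, Spinor) :=
  LineDeriv.lineDerivOpCLM ℝ 𝓢(Plane, Spinor) (planeVec j)

lemma planeDeriv_apply (j : Fin 2) (f : 𝓢(Plane, Spinor)) (x : Plane) :
    planeDeriv j f x = fderiv ℝ f x (planeVec j) := rfl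

/-- The polynomial weight `(1 + |X|²)^M`. -/
def polyWeight (M : ℕ) (x : Plane) : ℝ := (1 + ‖x‖ ^ 2) ^ M

lemma polyWeight_pos (M : ℕ) (x : Plane) : 0 < polyWeight M x := by unfold polyWeight; positivity

lemma polyWeight_temperate (M : ℕ) : (polyWeight M).HasTemperateGrowth := by
  have h : (fun x : Plane => 1 + ‖x‖ ^ 2).HasTemperateGrowth := by fun_prop
  exact h.pow M

lemma polyWeight_mul (M M' : ℕ) (x : Plane) :
    polyWeight M x * polyWeight M' x = polyWeight (M + M') x := (pow_add _ _ _).symm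

lemma one_add_norm_pow_le_polyWeight (M : ℕ) (x : Plane) : (1 + ‖x‖) ^ M ≤ 2 ^ M * polyWeight M x := by
  unfold polyWeight
  rw [← mul_pow]
  gcongr
  nlinarith [sq_nonneg (‖x‖ - 1)]

/-- The exponential form, equal to 1 at y = 0, lets the losses of many short translations multiply
to a bounded factor. -/
lemma polyWeight_add_le (M : ℕ) (x y : Plane) :
    polyWeight M (x + y) ≤ Real.exp (2 * M * ‖y‖) * polyWeight M x := by
  have h : 1 + ‖x + y‖ ^ 2 ≤ Real.exp (2 * ‖y‖) * (1 + ‖x‖ ^ 2) := by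
    have h1 : ‖x + y‖ ^ 2 ≤ (‖x‖ + ‖y‖) ^ 2 := by gcongr; exact norm_add_le x y
    have h2 : (1 + ‖y‖) ^ 2 ≤ Real.exp (2 * ‖y‖) := by
      rw [two_mul, Real.exp_add, ← sq]
      gcongr
      linarith [Real.add_one_le_exp ‖y‖]
    have h3 : 1 + (‖x‖ + ‖y‖) ^ 2 ≤ (1 + ‖y‖) ^ 2 * (1 + ‖x‖ ^ 2) := by
      nlinarith [mul_nonneg (norm_nonneg y) (sq_nonneg (‖x‖ - 1)), norm_nonneg x, norm_nonneg y,
        mul_nonneg (sq_nonneg ‖x‖) (sq_nonneg ‖y‖), mul_nonneg (norm_nonneg y) (sq_nonneg ‖x‖)]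
    calc _ ≤ 1 + (‖x‖ + ‖y‖) ^ 2 := by gcongr
      _ ≤ _ := h3
      _ ≤ _ := by gcongr
  calc polyWeight M (x + y) ≤ (Real.exp (2 * ‖y‖) * (1 + ‖x‖ ^ 2)) ^ M := by
        unfold polyWeight; gcongr
    _ = _ := by rw [mul_pow, ← Real.exp_nat_mul]; unfold polyWeight; congr 2; ring

/-- Multiplication by a real function of temperate growth. -/
abbrev mulCLM (a : Plane → ℝ) : 𝓢(Plane, Spinor) →L[ℝ] 𝓢(Plane, Spinor) :=
  SchwartzMap.smulLeftCLM Spinor a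

/-- The weighted Sobolev norms, with `k` derivatives and the weight `(1 + |X|²)^M`. -/
def sobNorm : ℕ → ℕ → Seminorm ℝ 𝓢(Plane, Spinor)
  | 0, M => (normSeminorm ℝ (Lp Spinor 2 (volume : Measure Plane))).comp
      ((SchwartzMap.toLpCLM ℝ Spinor 2 volume ∘L mulCLM (polyWeight M) :
        𝓢(Plane, Spinor) →L[ℝ] Lp Spinor 2 (volume : Measure Plane)) : _ →ₗ[ℝ] _)
  | k + 1, M => sobNorm k M + ∑ j : Fin 2, (sobNorm k M).comp (planeDeriv j : _ →ₗ[ℝ] _)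

lemma sobNorm_zero (M : ℕ) (f : 𝓢(Plane, Spinor)) :
    sobNorm 0 M f = ‖(mulCLM (polyWeight M) f).toLp 2 volume‖ := rfl

lemma sobNorm_succ (k M : ℕ) (f : 𝓢(Plane, Spinor)) :
    sobNorm (k + 1) M f = sobNorm k M f + (sobNorm k M (planeDeriv 0 f) + sobNorm k M (planeDeriv 1 f)) := by
  simp [sobNorm, Fin.sum_univ_two]

lemma continuous_sobNorm (k M : ℕ) : Continuous (sobNorm k M) := by
  induction k with
  | zero =>
    change Continuous fun f => ‖(SchwartzMap.toLpCLM ℝ Spinor 2 volume ∘L mulCLM (polyWeight M)) f‖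
    exact (ContinuousLinearMap.continuous _).norm
  | succ k ih =>
    have : ⇑(sobNorm (k + 1) M) = fun f => sobNorm k M f +
      (sobNorm k M (planeDeriv 0 f) + sobNorm k M (planeDeriv 1 f)) := funext (sobNorm_succ k M)
    rw [this]
    exact ih.add ((ih.comp (planeDeriv 0).continuous).add (ih.comp (planeDeriv 1).continuous))

lemma sobNorm_planeDeriv_le (k M : ℕ) (j : Fin 2) (f : 𝓢(Plane, Spinor)) :
    sobNorm k M (planeDeriv j f) ≤ sobNorm (k + 1) M f := by
  rw [sobNorm_succ]
  have h := apply_nonneg (sobNorm k M) f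
  have h0 := apply_nonneg (sobNorm k M) (planeDeriv 0 f)
  have h1 := apply_nonneg (sobNorm k M) (planeDeriv 1 f)
  fin_cases j <;> simp only [Fin.zero_eta, Fin.mk_one] <;> linarith

lemma mulCLM_apply {a : Plane → ℝ} (ha : a.HasTemperateGrowth) (f : 𝓢(Plane, Spinor)) (x : Plane) :
    mulCLM a f x = a x • f x := SchwartzMap.smulLeftCLM_apply_apply ha f x

/-- A pointwise bound controls the weighted `L²` norm. -/
lemma sobNorm_zero_le {M M' : ℕ} {C : ℝ} {f g : 𝓢(Plane, Spinor)}
    (h : ∀ x, polyWeight M x * ‖f x‖ ≤ C * (polyWeight M' x * ‖g x‖)) :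
    sobNorm 0 M f ≤ C * sobNorm 0 M' g := by
  rw [sobNorm_zero, sobNorm_zero]
  refine Lp.norm_le_mul_norm_of_ae_le_mul ?_
  filter_upwards [SchwartzMap.coeFn_toLp (mulCLM (polyWeight M) f) 2 volume,
    SchwartzMap.coeFn_toLp (mulCLM (polyWeight M') g) 2 volume] with x h1 h2
  rw [h1, h2, mulCLM_apply (polyWeight_temperate M), mulCLM_apply (polyWeight_temperate M'),
    norm_smul, norm_smul, Real.norm_of_nonneg (polyWeight_pos _ _).le,
    Real.norm_of_nonneg (polyWeight_pos _ _).le]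
  exact h x

/-- `r` is bounded by finitely many of the weighted Sobolev norms. -/
def SobDominated (r : 𝓢(Plane, Spinor) → ℝ) : Prop :=
  ∃ (C : ℝ) (s : Finset (ℕ × ℕ)), 0 ≤ C ∧ ∀ f, r f ≤ C * ∑ i ∈ s, sobNorm i.1 i.2 f

lemma SobDominated.mono {r r' : 𝓢(Plane, Spinor) → ℝ} (h : SobDominated r') (hr : ∀ f, r f ≤ r' f) :
    SobDominated r := by
  obtain ⟨C, s, hC, H⟩ := h
  exact ⟨C, s, hC, fun f => (hr f).trans (H f)⟩

lemma SobDominated.const_mul {r : 𝓢(Plane, Spinor) → ℝ} (h : SobDominated r) {c : ℝ} (hc : 0 ≤ c) :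
    SobDominated (fun f => c * r f) := by
  obtain ⟨C, s, hC, H⟩ := h
  exact ⟨c * C, s, by positivity, fun f => by
    rw [mul_assoc]; exact mul_le_mul_of_nonneg_left (H f) hc⟩

lemma SobDominated.add {r r' : 𝓢(Plane, Spinor) → ℝ} (h : SobDominated r) (h' : SobDominated r') :
    SobDominated (fun f => r f + r' f) := by
  classical
  obtain ⟨C, s, hC, H⟩ := h
  obtain ⟨C', s', hC', H'⟩ := h'
  refine ⟨C + C', s ∪ s', by positivity, fun f => ?_⟩
  have h1 : ∑ i ∈ s, sobNorm i.1 i.2 f ≤ ∑ i ∈ s ∪ s', sobNorm i.1 i.2 f :=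
    Finset.sum_le_sum_of_subset_of_nonneg Finset.subset_union_left fun _ _ _ => apply_nonneg _ _
  have h2 : ∑ i ∈ s', sobNorm i.1 i.2 f ≤ ∑ i ∈ s ∪ s', sobNorm i.1 i.2 f :=
    Finset.sum_le_sum_of_subset_of_nonneg Finset.subset_union_right fun _ _ _ => apply_nonneg _ _
  rw [add_mul]
  exact add_le_add ((H f).trans (by gcongr)) ((H' f).trans (by gcongr))

lemma sobDominated_sobNorm (k M : ℕ) : SobDominated (sobNorm k M) :=
  ⟨1, {(k, M)}, zero_le_one, fun f => by simp⟩

lemma SobDominated.comp {r : 𝓢(Plane, Spinor) → ℝ} (h : SobDominated r)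
    {A : 𝓢(Plane, Spinor) → 𝓢(Plane, Spinor)} (hA : ∀ k M, SobDominated fun f => sobNorm k M (A f)) :
    SobDominated (fun f => r (A f)) := by
  obtain ⟨C, s, hC, H⟩ := h
  have hs : ∀ s : Finset (ℕ × ℕ), SobDominated fun f => ∑ i ∈ s, sobNorm i.1 i.2 (A f) := by
    classical
    intro s
    induction s using Finset.induction_on with
    | empty => exact ⟨0, ∅, le_rfl, fun f => by simp⟩
    | insert i s hi ih =>
      simp only [Finset.sum_insert hi]
      exact (hA _ _).add ih
  exact ((hs s).const_mul hC).mono fun f => H (A f)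

lemma SobDominated.comp_planeDeriv {r : 𝓢(Plane, Spinor) → ℝ} (h : SobDominated r) (j : Fin 2) :
    SobDominated (fun f => r (planeDeriv j f)) :=
  h.comp fun k M => (sobDominated_sobNorm (k + 1) M).mono (sobNorm_planeDeriv_le k M j)

lemma fderiv_apply_temperate {a : Plane → ℝ} (ha : a.HasTemperateGrowth) (v : Plane) :
    (fun x => fderiv ℝ a x v).HasTemperateGrowth := by
  have hd : ContDiff ℝ ∞ (fderiv ℝ a) := ha.1.fderiv_right (by simp)
  refine ⟨hd.clm_apply contDiff_const, fun n => ?_⟩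
  obtain ⟨k, C, H⟩ := ha.2 (n + 1)
  refine ⟨k, ‖v‖ * C, fun x => ?_⟩
  refine (norm_iteratedFDeriv_clm_apply_const hd.contDiffAt (by exact_mod_cast le_top)).trans ?_
  rw [norm_iteratedFDeriv_fderiv, mul_assoc]
  gcongr
  exact H x

lemma planeDeriv_mulCLM {a : Plane → ℝ} (ha : a.HasTemperateGrowth) (j : Fin 2)
    (f : 𝓢(Plane, Spinor)) :
    planeDeriv j (mulCLM a f) =
      mulCLM (fun x => fderiv ℝ a x (planeVec j)) f + mulCLM a (planeDeriv j f) := by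
  ext1 x
  have e : ⇑(mulCLM a f) = fun y => a y • f y := funext fun y => mulCLM_apply ha f y
  have hda : DifferentiableAt ℝ a x := (ha.1.differentiable (by simp)) x
  rw [planeDeriv_apply, e, fderiv_fun_smul hda f.differentiableAt]
  change _ = mulCLM _ f x + mulCLM a (planeDeriv j f) x
  rw [mulCLM_apply (fderiv_apply_temperate ha _), mulCLM_apply ha, planeDeriv_apply]
  simp [add_comm]

/-- Polynomial growth of the symbol is paid for by a higher weight; the product rule handles
derivatives. -/
lemma SobDominated.mulCLM {a : Plane → ℝ} (ha : a.HasTemperateGrowth) (k M : ℕ) :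
    SobDominated fun f => sobNorm k M (mulCLM a f) := by
  induction k generalizing a with
  | zero =>
    obtain ⟨m, C, H⟩ := ha.2 0
    have hC : 0 ≤ C := by simpa using (norm_nonneg _).trans (H 0)
    refine ((sobDominated_sobNorm 0 (M + m)).const_mul (c := C * 2 ^ m) (by positivity)).mono
      fun f => sobNorm_zero_le fun x => ?_
    rw [mulCLM_apply ha, norm_smul, ← polyWeight_mul]
    have h1 : ‖a x‖ ≤ C * (1 + ‖x‖) ^ m := by simpa using H x
    have h2 := one_add_norm_pow_le_polyWeight m x
    have h3 : ‖a x‖ ≤ C * (2 ^ m * polyWeight m x) := h1.trans (by gcongr)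
    calc polyWeight M x * (‖a x‖ * ‖f x‖)
        ≤ polyWeight M x * (C * (2 ^ m * polyWeight m x) * ‖f x‖) := by
          have := (polyWeight_pos M x).le
          gcongr
      _ = _ := by ring
  | succ k ih =>
    have hj : ∀ j, SobDominated fun f => sobNorm k M (planeDeriv j (_root_.mulCLM a f)) := fun j => by
      refine SobDominated.mono ((ih (fderiv_apply_temperate ha (planeVec j))).add
        ((ih ha).comp_planeDeriv j)) fun f => ?_
      rw [planeDeriv_mulCLM ha]
      exact map_add_le_add _ _ _
    simp only [sobNorm_succ]
    exact (ih ha).add ((hj 0).add (hj 1))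

lemma IsSmoothBounded.temperate {κ : Plane → ℝ} (h : IsSmoothBounded κ) : κ.HasTemperateGrowth :=
  ⟨h.1, fun n => by
    obtain ⟨C, H⟩ := h.2 n
    exact ⟨0, C, fun x => by simpa using H x⟩⟩

lemma IsSmoothBounded.fderiv_apply {κ : Plane → ℝ} (h : IsSmoothBounded κ) (v : Plane) :
    IsSmoothBounded (fun x => fderiv ℝ κ x v) := by
  have hd : ContDiff ℝ ∞ (fderiv ℝ κ) := h.1.fderiv_right (by simp)
  refine ⟨hd.clm_apply contDiff_const, fun n => ?_⟩
  obtain ⟨C, H⟩ := h.2 (n + 1)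
  refine ⟨‖v‖ * C, fun x => ?_⟩
  refine (norm_iteratedFDeriv_clm_apply_const hd.contDiffAt (by exact_mod_cast le_top)).trans ?_
  rw [norm_iteratedFDeriv_fderiv]
  gcongr
  exact H x

/-- A symbol in C_b^∞ loses neither weight nor derivatives. Having the same norm on both sides is
what makes the Euler step stable. -/
lemma sobNorm_mulCLM_le {κ : Plane → ℝ} (hκ : IsSmoothBounded κ) (k M : ℕ) :
    ∃ C : ℝ, 0 ≤ C ∧ ∀ f, sobNorm k M (mulCLM κ f) ≤ C * sobNorm k M f := by
  induction k generalizing κ with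
  | zero =>
    obtain ⟨C, H⟩ := hκ.2 0
    have hC : 0 ≤ C := (norm_nonneg _).trans (H 0)
    refine ⟨C, hC, fun f => sobNorm_zero_le fun x => ?_⟩
    have h1 : ‖κ x‖ ≤ C := by simpa using H x
    rw [mulCLM_apply hκ.temperate, norm_smul]
    have := (polyWeight_pos M x).le
    calc polyWeight M x * (‖κ x‖ * ‖f x‖) ≤ polyWeight M x * (C * ‖f x‖) := by gcongr
      _ = _ := by ring
  | succ k ih =>
    obtain ⟨C, hC, H⟩ := ih hκ
    obtain ⟨C0, hC0, H0⟩ := ih (hκ.fderiv_apply (planeVec 0))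
    obtain ⟨C1, hC1, H1⟩ := ih (hκ.fderiv_apply (planeVec 1))
    refine ⟨C + C0 + C1, by positivity, fun f => ?_⟩
    rw [sobNorm_succ, sobNorm_succ, planeDeriv_mulCLM hκ.temperate, planeDeriv_mulCLM hκ.temperate]
    have a := H f
    have b0 := (map_add_le_add (sobNorm k M) _ _).trans (add_le_add (H0 f) (H (planeDeriv 0 f)))
    have b1 := (map_add_le_add (sobNorm k M) _ _).trans (add_le_add (H1 f) (H (planeDeriv 1 f)))
    have n0 := apply_nonneg (sobNorm k M) (planeDeriv 0 f)
    have n1 := apply_nonneg (sobNorm k M) (planeDeriv 1 f)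
    nlinarith [mul_nonneg hC0 n0, mul_nonneg hC0 n1, mul_nonneg hC1 n0, mul_nonneg hC1 n1]

end Weighted

/-! ### Sobolev embedding: the weighted norms control all Schwartz seminorms. -/

section Embedding

lemma sobNorm_zero_zero (f : 𝓢(Plane, Spinor)) : sobNorm 0 0 f = ‖f.toLp 2 volume‖ := by
  rw [sobNorm_zero]
  congr 2
  ext1 x
  rw [mulCLM_apply (polyWeight_temperate 0)]
  simp [polyWeight]

lemma norm_toLp_two_sq (f : 𝓢(Plane, Spinor)) : ‖f.toLp 2 volume‖ = (∫ x, ‖f x‖ ^ 2) ^ (1 / 2 : ℝ) := by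
  rw [SchwartzMap.norm_toLp' (by simp) (by simp)]
  simp

/-- The `L¹` norm is controlled by a weighted `L²` norm. -/
lemma integral_norm_le_weighted : ∃ C : ℝ, 0 ≤ C ∧ ∀ f : 𝓢(Plane, Spinor),
    ∫ x, ‖f x‖ ≤ C * ‖(mulCLM (polyWeight 1) f).toLp 2 volume‖ := by
  have hw : MemLp (fun x : Plane => (1 + ‖x‖ ^ 2)⁻¹) (ENNReal.ofReal 2) volume := by
    have hcont : Continuous fun x : Plane => (1 + ‖x‖ ^ 2)⁻¹ :=
      Continuous.inv₀ (by fun_prop) fun x => by positivity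
    rw [ENNReal.ofReal_ofNat, memLp_two_iff_integrable_sq hcont.aestronglyMeasurable]
    -- Cauchy–Schwarz needs (1 + |x|²)⁻² to be integrable; its decay exponent 4 exceeds the
    -- dimension 2.
    have := integrable_rpow_neg_one_add_norm_sq (E := Plane) (μ := volume) (r := 4) (by simp; norm_num)
    refine this.congr (Filter.Eventually.of_forall fun x => ?_)
    simp only
    rw [show (-4 / 2 : ℝ) = ((-2 : ℤ) : ℝ) by norm_num, Real.rpow_intCast, zpow_neg, inv_pow]
    rfl
  refine ⟨(∫ x : Plane, ‖(1 + ‖x‖ ^ 2 : ℝ)⁻¹‖ ^ (2 : ℝ)) ^ (1 / 2 : ℝ), by positivity, fun f => ?_⟩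
  have hf : MemLp (mulCLM (polyWeight 1) f) (ENNReal.ofReal 2) volume := by
    rw [ENNReal.ofReal_ofNat]
    exact SchwartzMap.memLp _ 2 volume
  have := integral_mul_norm_le_Lp_mul_Lq Real.HolderConjugate.two_two hw hf.norm
  rw [norm_toLp_two_sq]
  simp only [Real.rpow_two, norm_norm] at this ⊢
  refine le_trans (le_of_eq ?_) this
  refine integral_congr_ae (Filter.Eventually.of_forall fun x => ?_)
  simp only
  have h0 : (0 : ℝ) < 1 + ‖x‖ ^ 2 := by positivity
  rw [mulCLM_apply (polyWeight_temperate 1), norm_smul, norm_inv, ← mul_assoc]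
  simp only [polyWeight, pow_one]
  rw [inv_mul_cancel₀ (norm_ne_zero_iff.2 h0.ne'), one_mul]

lemma fourier_sub_laplacian (g : 𝓢(Plane, Spinor)) :
    𝓕 (g - ((2 * Real.pi) ^ 2)⁻¹ • Δ g) = mulCLM (polyWeight 1) (𝓕 g) := by
  have hΔ : 𝓕 (Δ g) = -((2 * Real.pi) ^ 2) • mulCLM (‖·‖ ^ 2) (𝓕 g) := by
    rw [SchwartzMap.laplacian_eq_fourierMultiplierCLM, SchwartzMap.fourierMultiplierCLM_apply,
      FourierTransform.fourier_smul, FourierTransform.fourier_fourierInv_eq]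
  have ht : ((‖·‖ ^ 2) : Plane → ℝ).HasTemperateGrowth := by fun_prop
  have hc : (2 * Real.pi) ^ 2 ≠ 0 := by positivity
  have hF : ∀ f : 𝓢(Plane, Spinor), 𝓕 f = FourierTransform.fourierCLM ℝ 𝓢(Plane, Spinor) f :=
    fun _ => rfl
  rw [hF, map_sub, map_smul, ← hF, ← hF, hΔ]
  ext1 x
  change 𝓕 g x - ((2 * Real.pi) ^ 2)⁻¹ • (-((2 * Real.pi) ^ 2) • mulCLM (‖·‖ ^ 2) (𝓕 g) x) = _
  rw [mulCLM_apply (polyWeight_temperate 1), mulCLM_apply ht, neg_smul, smul_neg, smul_smul,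
    inv_mul_cancel₀ hc]
  simp [polyWeight, add_smul]

/-- H² embeds in L^∞ in the plane: |g(x)| is at most the L¹ norm of the Fourier transform, hence at
most C times the L² norm of (1 + |ξ|²) 𝓕 g. By Plancherel the latter is the L² norm of g - (2π)⁻² Δ
g. -/
lemma norm_apply_le_sobNorm : ∃ C : ℝ, 0 ≤ C ∧ ∀ (g : 𝓢(Plane, Spinor)) (x : Plane),
    ‖g x‖ ≤ C * sobNorm 2 0 g := by
  obtain ⟨C, hC, H⟩ := integral_norm_le_weighted
  set c : ℝ := ((2 * Real.pi) ^ 2)⁻¹ with hc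
  refine ⟨C * (1 + c), by positivity, fun g x => ?_⟩
  have h1 : ‖g x‖ ≤ ‖(𝓕 g).toLp 1 volume‖ := by
    have e : g x = 𝓕 (𝓕 g) (-x) := by
      have := SchwartzMap.fourierInv_apply_eq (𝓕 g)
      rw [FourierTransform.fourierInv_fourier_eq] at this
      conv_lhs => rw [this]
      simp
    rw [e]
    exact SchwartzMap.norm_fourier_apply_le_toLp_one _ _
  rw [SchwartzMap.norm_toLp_one] at h1
  have h2 := H (𝓕 g)
  rw [← fourier_sub_laplacian, SchwartzMap.norm_fourier_toL2_eq] at h2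
  have h3 : ‖(g - c • Δ g).toLp 2 volume‖ ≤ (1 + c) * sobNorm 2 0 g := by
    rw [← sobNorm_zero_zero]
    have e : Δ g = planeDeriv 0 (planeDeriv 0 g) + planeDeriv 1 (planeDeriv 1 g) := by
      rw [SchwartzMap.laplacian_eq_sum (EuclideanSpace.basisFun (Fin 2) ℝ), Fin.sum_univ_two]
      simp [EuclideanSpace.basisFun_apply]
    have t1 := map_sub_le_add (sobNorm 0 0) g (c • Δ g)
    have t2 : sobNorm 0 0 (c • Δ g) = c * sobNorm 0 0 (Δ g) := by
      rw [map_smul_eq_mul, Real.norm_of_nonneg (by positivity)]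
    have t3 : sobNorm 0 0 (Δ g) ≤ sobNorm 0 0 (planeDeriv 0 (planeDeriv 0 g)) + sobNorm 0 0 (planeDeriv 1 (planeDeriv 1 g)) := by
      rw [e]; exact map_add_le_add _ _ _
    have hc0 : 0 ≤ c := by positivity
    have n1 := apply_nonneg (sobNorm 0 0) g
    have n2 := fun j => apply_nonneg (sobNorm 0 0) (planeDeriv j g)
    have n3 := fun i j => apply_nonneg (sobNorm 0 0) (planeDeriv i (planeDeriv j g))
    have e2 : sobNorm 0 0 g + sobNorm 0 0 (planeDeriv 0 (planeDeriv 0 g)) +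
        sobNorm 0 0 (planeDeriv 1 (planeDeriv 1 g)) ≤ sobNorm 2 0 g := by
      simp only [sobNorm_succ]
      linarith [n2 0, n2 1, n3 0 1, n3 1 0]
    nlinarith [n3 0 0, n3 1 1]
  calc _ ≤ _ := h1
    _ ≤ _ := h2
    _ ≤ C * ((1 + c) * sobNorm 2 0 g) := by gcongr
    _ = _ := by ring

lemma sobDominated_seminorm_zero (m : ℕ) :
    SobDominated (SchwartzMap.seminorm ℝ m 0 : Seminorm ℝ 𝓢(Plane, Spinor)) := by
  obtain ⟨C, hC, H⟩ := norm_apply_le_sobNorm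
  refine ((SobDominated.mulCLM (polyWeight_temperate m) 2 0).const_mul hC).mono fun f => ?_
  refine SchwartzMap.seminorm_le_bound ℝ m 0 f (mul_nonneg hC (apply_nonneg _ _)) fun x => ?_
  rw [norm_iteratedFDeriv_zero]
  refine le_trans ?_ (H _ x)
  rw [mulCLM_apply (polyWeight_temperate m), norm_smul, Real.norm_of_nonneg (polyWeight_pos _ _).le]
  unfold polyWeight
  gcongr
  nlinarith [sq_nonneg (‖x‖ - 1)]

/-- The two coordinate derivatives determine the full derivative, which permits induction on the
order. -/
lemma seminorm_succ_le (m k : ℕ) : ∃ C : ℝ, 0 ≤ C ∧ ∀ f : 𝓢(Plane, Spinor),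
    SchwartzMap.seminorm ℝ m (k + 1) f ≤ C * (SchwartzMap.seminorm ℝ m k (planeDeriv 0 f) +
      SchwartzMap.seminorm ℝ m k (planeDeriv 1 f)) := by
  let L : Fin 2 → Spinor →L[ℝ] Plane →L[ℝ] Spinor := fun j =>
    ContinuousLinearMap.smulRightL ℝ Plane Spinor (EuclideanSpace.proj j : Plane →L[ℝ] ℝ)
  refine ⟨‖L 0‖ + ‖L 1‖, by positivity, fun f => ?_⟩
  refine SchwartzMap.seminorm_le_bound ℝ m (k + 1) f (by positivity) fun x => ?_
  have e : fderiv ℝ f = (L 0 ∘ planeDeriv 0 f) + (L 1 ∘ planeDeriv 1 f) := by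
    funext y
    ext1 v
    have hv : v = v 0 • planeVec 0 + v 1 • planeVec 1 := by
      ext i; fin_cases i <;> simp
    conv_lhs => rw [hv]
    simp only [map_add, map_smul, Pi.add_apply, Function.comp_apply, add_apply]
    rfl
  have hs : ∀ j, ContDiff ℝ k (planeDeriv j f) := fun j => (planeDeriv j f).smooth k
  have h1 : ∀ j, ‖iteratedFDeriv ℝ k (L j ∘ planeDeriv j f) x‖ ≤
      ‖L j‖ * ‖iteratedFDeriv ℝ k (planeDeriv j f) x‖ := fun j =>
    (L j).norm_iteratedFDeriv_comp_left (hs j).contDiffAt le_rfl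
  have h2 : ∀ j, ‖x‖ ^ m * ‖iteratedFDeriv ℝ k (planeDeriv j f) x‖ ≤
      SchwartzMap.seminorm ℝ m k (planeDeriv j f) := fun j => SchwartzMap.le_seminorm ℝ m k _ x
  rw [← norm_iteratedFDeriv_fderiv, e, iteratedFDeriv_add_apply
    ((L 0).contDiff.comp (hs 0)).contDiffAt ((L 1).contDiff.comp (hs 1)).contDiffAt]
  have n0 : 0 ≤ SchwartzMap.seminorm ℝ m k (planeDeriv 0 f) := apply_nonneg _ _
  have n1 : 0 ≤ SchwartzMap.seminorm ℝ m k (planeDeriv 1 f) := apply_nonneg _ _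
  calc _ ≤ ‖x‖ ^ m * (‖L 0‖ * ‖iteratedFDeriv ℝ k (planeDeriv 0 f) x‖ +
        ‖L 1‖ * ‖iteratedFDeriv ℝ k (planeDeriv 1 f) x‖) := by
        gcongr
        exact (norm_add_le _ _).trans (add_le_add (h1 0) (h1 1))
    _ = ‖L 0‖ * (‖x‖ ^ m * ‖iteratedFDeriv ℝ k (planeDeriv 0 f) x‖) +
        ‖L 1‖ * (‖x‖ ^ m * ‖iteratedFDeriv ℝ k (planeDeriv 1 f) x‖) := by ring
    _ ≤ ‖L 0‖ * SchwartzMap.seminorm ℝ m k (planeDeriv 0 f) +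
        ‖L 1‖ * SchwartzMap.seminorm ℝ m k (planeDeriv 1 f) := by
        gcongr <;> exact h2 _
    _ ≤ _ := by nlinarith [mul_nonneg (norm_nonneg (L 0)) n1, mul_nonneg (norm_nonneg (L 1)) n0]

lemma sobDominated_seminorm (m k : ℕ) :
    SobDominated (SchwartzMap.seminorm ℝ m k : Seminorm ℝ 𝓢(Plane, Spinor)) := by
  induction k with
  | zero => exact sobDominated_seminorm_zero m
  | succ k ih =>
    obtain ⟨C, hC, H⟩ := seminorm_succ_le m k
    exact (((ih.comp_planeDeriv 0).add (ih.comp_planeDeriv 1)).const_mul hC).mono H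

/-- The weighted Sobolev norms generate the topology of the Schwartz space. -/
lemma sobDominated_of_continuous {q : Seminorm ℝ 𝓢(Plane, Spinor)} (hq : Continuous q) :
    SobDominated q := by
  obtain ⟨s, C, -, H⟩ := Seminorm.bound_of_continuous (schwartz_withSeminorms ℝ Plane Spinor) q hq
  have hs : ∀ s : Finset (ℕ × ℕ), 
      SobDominated (s.sup (schwartzSeminormFamily ℝ Plane Spinor) : Seminorm ℝ 𝓢(Plane, Spinor)) := by
    classical
    intro s
    induction s using Finset.induction_on with
    | empty => exact ⟨0, ∅, le_rfl, fun f => by simp⟩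
    | insert i s hi ih =>
      refine ((sobDominated_seminorm i.1 i.2).add ih).mono fun f => ?_
      rw [Finset.sup_insert, Seminorm.sup_apply]
      exact max_le_add_of_nonneg (apply_nonneg _ _) (apply_nonneg _ _)
  exact ((hs s).const_mul C.2).mono fun f => H f

end Embedding

/-! ### Stability and consistency tested on the weighted Sobolev norms. -/

section Criteria

lemma Seminorm.exists_weighted_sum {ι V : Type*} [AddCommGroup V] [Module ℝ V] [TopologicalSpace V]
    {N : ι → Seminorm ℝ V} (hN : ∀ i, Continuous (N i)) {c : ι → ℝ} (hc : ∀ i, 0 ≤ c i)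
    (s : Finset ι) : ∃ q : Seminorm ℝ V, Continuous q ∧ ∀ f, q f = ∑ i ∈ s, c i * N i f := by
  classical
  induction s using Finset.induction_on with
  | empty => exact ⟨0, continuous_const, fun f => by simp⟩
  | insert i s hi ih =>
    obtain ⟨q, hq, H⟩ := ih
    refine ⟨(c i).toNNReal • N i + q, Seminorm.continuous_add ?_ hq, fun f => ?_⟩
    · rw [FunLike.coe_smul]; exact (hN i).const_smul _
    · rw [Finset.sum_insert hi, add_apply, smul_apply, NNReal.smul_def, smul_eq_mul,
        Real.coe_toNNReal _ (hc i), H]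

/-- With the same norm on both sides, m steps cost exp(C m t), which is bounded while m t ≤ ρ. -/
lemma isStable_of_sobNorm_le {S : ℝ → Module.End ℝ 𝓢(Plane, Spinor)}
    (h : ∀ k M : ℕ, ∃ C : ℝ, 0 ≤ C ∧ ∀ t ∈ Icc (0 : ℝ) 1, ∀ g,
      sobNorm k M (S t g) ≤ Real.exp (C * t) * sobNorm k M g) : IsStable S := by
  choose C hC H using h
  have iter : ∀ k M : ℕ, ∀ t ∈ Icc (0 : ℝ) 1, ∀ (m : ℕ) g,
      sobNorm k M ((S t ^ m) g) ≤ Real.exp (C k M * (m * t)) * sobNorm k M g := by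
    intro k M t ht m g
    induction m with
    | zero => simp
    | succ m ih =>
      rw [pow_succ', Module.End.mul_apply]
      refine (H k M t ht _).trans ?_
      calc _ ≤ Real.exp (C k M * t) * (Real.exp (C k M * (m * t)) * sobNorm k M g) := by gcongr
        _ = _ := by rw [← mul_assoc, ← Real.exp_add]; push_cast; ring_nf
  intro q hq ρ
  obtain ⟨D, s, hD, HD⟩ := sobDominated_of_continuous hq
  obtain ⟨q', hq', H'⟩ := Seminorm.exists_weighted_sum
    (N := fun i : ℕ × ℕ => sobNorm i.1 i.2) (fun i => continuous_sobNorm i.1 i.2)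
    (c := fun i => D * Real.exp (C i.1 i.2 * ρ)) (fun i => by positivity) s
  refine ⟨q', hq', fun t ht m hm g => ?_⟩
  rw [H']
  refine (HD _).trans ?_
  rw [Finset.mul_sum]
  refine Finset.sum_le_sum fun i _ => ?_
  rw [mul_assoc]
  gcongr
  refine (iter i.1 i.2 t ht m g).trans ?_
  have := hC i.1 i.2
  gcongr

lemma isConsistent_of_sobNorm_le {S : ℝ → Module.End ℝ 𝓢(Plane, Spinor)}
    {A : 𝓢(Plane, Spinor) →L[ℝ] 𝓢(Plane, Spinor)}
    (h : ∀ k M : ℕ, ∃ q' : Seminorm ℝ 𝓢(Plane, Spinor), Continuous q' ∧ ∀ t ∈ Icc (0 : ℝ) 1, ∀ g,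
      sobNorm k M (S t g - g - t • A g) ≤ t ^ 2 * q' g) : IsConsistent S A := by
  choose q' hq' H using h
  intro q hq
  obtain ⟨D, s, hD, HD⟩ := sobDominated_of_continuous hq
  obtain ⟨q, hq, H'⟩ := Seminorm.exists_weighted_sum (N := fun i : ℕ × ℕ => q' i.1 i.2)
    (fun i => hq' i.1 i.2) (c := fun _ => D) (fun i => hD) s
  refine ⟨q, hq, fun t ht g => ?_⟩
  rw [H', Finset.mul_sum]
  refine (HD _).trans ?_
  rw [Finset.mul_sum]
  refine Finset.sum_le_sum fun i _ => ?_
  rw [mul_left_comm]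
  gcongr
  exact H i.1 i.2 t ht g

end Criteria

/-! ### Exact transport along spectral components, and Taylor remainders of translations. -/

section Transport

lemma planeDeriv_postcompCLM (j : Fin 2) (L : Spinor →L[ℝ] Spinor) (f : 𝓢(Plane, Spinor)) :
    planeDeriv j (SchwartzMap.postcompCLM L f) = SchwartzMap.postcompCLM L (planeDeriv j f) := by
  ext1 x
  have e : ⇑(SchwartzMap.postcompCLM L f) = L ∘ f := rfl
  rw [planeDeriv_apply, e, fderiv_comp x L.differentiableAt f.differentiableAt, ContinuousLinearMap.fderiv]
  rfl

lemma planeDeriv_compSubConstCLM (j : Fin 2) (a : Plane) (f : 𝓢(Plane, Spinor)) :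
    planeDeriv j (SchwartzMap.compSubConstCLM ℝ a f) =
      SchwartzMap.compSubConstCLM ℝ a (planeDeriv j f) := by
  ext1 x
  have e : ⇑(SchwartzMap.compSubConstCLM ℝ a f) = fun y => f (y - a) := rfl
  rw [planeDeriv_apply, e, fderiv_comp_sub]
  rfl

lemma planeDeriv_comm (i j : Fin 2) (f : 𝓢(Plane, Spinor)) :
    planeDeriv i (planeDeriv j f) = planeDeriv j (planeDeriv i f) := by
  ext1 x
  have h : ∀ i j, planeDeriv i (planeDeriv j f) x = fderiv ℝ (fderiv ℝ f) x (planeVec i) (planeVec j) := by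
    intro i j
    have e : ⇑(planeDeriv j f) = fun y => fderiv ℝ f y (planeVec j) := rfl
    have hd : DifferentiableAt ℝ (fderiv ℝ f) x :=
      (((f.smooth ⊤).fderiv_right (m := 1) (by norm_cast)).differentiable (by simp)) x
    rw [planeDeriv_apply, e, fderiv_clm_apply hd (differentiableAt_const _)]
    simp
  rw [h, h]
  exact ((f.smooth ⊤).contDiffAt.isSymmSndFDerivAt (by simp; norm_cast)).eq _ _

lemma sobNorm_postcompCLM_le (L : Spinor →L[ℝ] Spinor) (k M : ℕ) (f : 𝓢(Plane, Spinor)) :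
    sobNorm k M (SchwartzMap.postcompCLM L f) ≤ ‖L‖ * sobNorm k M f := by
  induction k generalizing f with
  | zero =>
    refine sobNorm_zero_le fun x => ?_
    have := (polyWeight_pos M x).le
    calc _ ≤ polyWeight M x * (‖L‖ * ‖f x‖) := by gcongr; exact L.le_opNorm _
      _ = _ := by ring
  | succ k ih =>
    simp only [sobNorm_succ, planeDeriv_postcompCLM]
    linarith [ih f, ih (planeDeriv 0 f), ih (planeDeriv 1 f)]

lemma sobNorm_zero_sq (M : ℕ) (f : 𝓢(Plane, Spinor)) :
    sobNorm 0 M f ^ 2 = ∫ x, (polyWeight M x * ‖f x‖) ^ 2 := by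
  rw [sobNorm_zero, norm_toLp_two_sq, ← Real.rpow_two, ← Real.rpow_mul (by positivity)]
  norm_num
  refine integral_congr_ae (Filter.Eventually.of_forall fun x => ?_)
  simp only
  rw [mulCLM_apply (polyWeight_temperate M), norm_smul, Real.norm_of_nonneg (polyWeight_pos _ _).le]

lemma integrable_polyWeight_norm_sq (M : ℕ) (f : 𝓢(Plane, Spinor)) :
    Integrable fun x => (polyWeight M x * ‖f x‖) ^ 2 := by
  have := ((mulCLM (polyWeight M) f).memLp 2 volume).integrable_norm_pow (by simp)
  refine this.congr (Filter.Eventually.of_forall fun x => ?_)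
  simp only
  rw [mulCLM_apply (polyWeight_temperate M), norm_smul, Real.norm_of_nonneg (polyWeight_pos _ _).le]

/-- A change of variables moves the translation onto the weight. -/
lemma sobNorm_zero_compSubConst_le (M : ℕ) (a : Plane) (f : 𝓢(Plane, Spinor)) :
    sobNorm 0 M (SchwartzMap.compSubConstCLM ℝ a f) ≤ Real.exp (2 * M * ‖a‖) * sobNorm 0 M f := by
  refine le_of_sq_le_sq ?_ (mul_nonneg (Real.exp_pos _).le (apply_nonneg _ _))
  rw [mul_pow, sobNorm_zero_sq, sobNorm_zero_sq]
  have := integral_sub_right_eq_self (μ := (volume : Measure Plane))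
    (fun x => (polyWeight M (x + a) * ‖f x‖) ^ 2) a
  simp only [sub_add_cancel] at this
  simp only [SchwartzMap.compSubConstCLM_apply]
  rw [this, ← integral_const_mul]
  refine integral_mono_of_nonneg (Filter.Eventually.of_forall fun x => sq_nonneg _)
    ((integrable_polyWeight_norm_sq M f).const_mul _) (Filter.Eventually.of_forall fun x => ?_)
  simp only
  rw [← mul_pow, ← mul_assoc]
  have := (polyWeight_pos M (x + a)).le
  gcongr
  exact polyWeight_add_le M x a

lemma sobNorm_zero_pythagoras (M : ℕ) {f g k : 𝓢(Plane, Spinor)}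
    (h : ∀ x, ‖f x‖ ^ 2 = ‖g x‖ ^ 2 + ‖k x‖ ^ 2) :
    sobNorm 0 M f ^ 2 = sobNorm 0 M g ^ 2 + sobNorm 0 M k ^ 2 := by
  rw [sobNorm_zero_sq, sobNorm_zero_sq, sobNorm_zero_sq, ← integral_add
    (integrable_polyWeight_norm_sq M g) (integrable_polyWeight_norm_sq M k)]
  refine integral_congr_ae (Filter.Eventually.of_forall fun x => ?_)
  simp only
  rw [mul_pow, mul_pow, mul_pow, h, mul_add]

/-- A Hermitian involution of the spinor space. -/
structure IsHermitianInvolution (A : Spinor →L[ℂ] Spinor) : Prop where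
  symm : ∀ u v, inner ℂ (A u) v = inner ℂ u (A v)
  invol : ∀ u, A (A u) = u

/-- The spectral projection `(1 ± A) / 2` of a Hermitian involution, for `ε = ±1`. -/
def specProj (A : Spinor →L[ℂ] Spinor) (ε : ℝ) : Spinor →L[ℝ] Spinor :=
  (1 / 2 : ℝ) • (ContinuousLinearMap.id ℝ Spinor + ε • A.restrictScalars ℝ)

lemma specProj_apply (A : Spinor →L[ℂ] Spinor) (ε : ℝ) (u : Spinor) :
    specProj A ε u = (1 / 2 : ℝ) • (u + ε • A u) := rfl

lemma specProj_add_specProj (A : Spinor →L[ℂ] Spinor) (u : Spinor) :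
    specProj A 1 u + specProj A (-1) u = u := by
  rw [specProj_apply, specProj_apply]; module

lemma specProj_sub_specProj (A : Spinor →L[ℂ] Spinor) (u : Spinor) :
    specProj A 1 u - specProj A (-1) u = A u := by
  rw [specProj_apply, specProj_apply]; module

/-- The projections (1 ± A)/2 have orthogonal ranges, so Pythagoras holds even when they act on
different vectors. -/
lemma IsHermitianInvolution.norm_specProj_add {A : Spinor →L[ℂ] Spinor} (hA : IsHermitianInvolution A)
    (u v : Spinor) : ‖specProj A 1 u + specProj A (-1) v‖ ^ 2 =
      ‖specProj A 1 u‖ ^ 2 + ‖specProj A (-1) v‖ ^ 2 := by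
  have h : inner ℂ (specProj A 1 u) (specProj A (-1) v) = 0 := by
    rw [specProj_apply, specProj_apply, ← Complex.coe_smul (1 / 2) (u + _),
      ← Complex.coe_smul (1 / 2) (v + _), inner_smul_left, inner_smul_right]
    simp only [one_smul, neg_smul, inner_add_left, inner_add_right, inner_neg_right, hA.symm,
      hA.invol]
    ring
  rw [norm_add_sq (𝕜 := ℂ), h]
  simp

/-- Transport along `± e` of the two spectral components. -/
def transport (A : Spinor →L[ℂ] Spinor) (e : Plane) (s : ℝ) :
    𝓢(Plane, Spinor) →L[ℝ] 𝓢(Plane, Spinor) :=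
  SchwartzMap.postcompCLM (specProj A 1) ∘L SchwartzMap.compSubConstCLM ℝ (-(s • e)) +
    SchwartzMap.postcompCLM (specProj A (-1)) ∘L SchwartzMap.compSubConstCLM ℝ (s • e)

lemma transport_eq (A : Spinor →L[ℂ] Spinor) (e : Plane) (s : ℝ) (f : 𝓢(Plane, Spinor)) :
    transport A e s f =
      SchwartzMap.postcompCLM (specProj A 1) (SchwartzMap.compSubConstCLM ℝ (-(s • e)) f) +
      SchwartzMap.postcompCLM (specProj A (-1)) (SchwartzMap.compSubConstCLM ℝ (s • e) f) := rfl

lemma planeDeriv_transport (j : Fin 2) (A : Spinor →L[ℂ] Spinor) (e : Plane) (s : ℝ)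
    (f : 𝓢(Plane, Spinor)) : planeDeriv j (transport A e s f) = transport A e s (planeDeriv j f) := by
  simp only [transport_eq, map_add, planeDeriv_postcompCLM, planeDeriv_compSubConstCLM]

/-- Orthogonality splits the squared norm of the output and of the input alike, and each component
is merely translated. A triangle inequality would leave a constant above 1 that explodes under
iteration. Derivatives commute with the transport. -/
lemma IsHermitianInvolution.sobNorm_transport_le {A : Spinor →L[ℂ] Spinor}
    (hA : IsHermitianInvolution A) (e : Plane) (s : ℝ) (k M : ℕ) (f : 𝓢(Plane, Spinor)) :
    sobNorm k M (transport A e s f) ≤ Real.exp (2 * M * ‖s • e‖) * sobNorm k M f := by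
  induction k generalizing f with
  | zero =>
    have e1 : sobNorm 0 M (transport A e s f) ^ 2 =
        sobNorm 0 M (SchwartzMap.compSubConstCLM ℝ (-(s • e))
          (SchwartzMap.postcompCLM (specProj A 1) f)) ^ 2 +
        sobNorm 0 M (SchwartzMap.compSubConstCLM ℝ (s • e)
          (SchwartzMap.postcompCLM (specProj A (-1)) f)) ^ 2 :=
      sobNorm_zero_pythagoras M fun x => hA.norm_specProj_add (f (x - -(s • e))) (f (x - s • e))
    have e2 : sobNorm 0 M f ^ 2 = sobNorm 0 M (SchwartzMap.postcompCLM (specProj A 1) f) ^ 2 +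
        sobNorm 0 M (SchwartzMap.postcompCLM (specProj A (-1)) f) ^ 2 :=
      sobNorm_zero_pythagoras M fun x => by
        have := hA.norm_specProj_add (f x) (f x)
        rwa [specProj_add_specProj] at this
    refine le_of_sq_le_sq ?_ (mul_nonneg (Real.exp_pos _).le (apply_nonneg _ _))
    have h1 := sobNorm_zero_compSubConst_le M (-(s • e)) (SchwartzMap.postcompCLM (specProj A 1) f)
    rw [norm_neg] at h1
    have h2 := sobNorm_zero_compSubConst_le M (s • e) (SchwartzMap.postcompCLM (specProj A (-1)) f)
    rw [mul_pow, e1, e2, mul_add, ← mul_pow, ← mul_pow]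
    exact add_le_add (pow_le_pow_left₀ (apply_nonneg _ _) h1 2)
      (pow_le_pow_left₀ (apply_nonneg _ _) h2 2)
  | succ k ih =>
    simp only [sobNorm_succ, planeDeriv_transport]
    linarith [ih f, ih (planeDeriv 0 f), ih (planeDeriv 1 f)]

/-- The second order Taylor remainder of a translation. -/
def translateRem (i : Fin 2) (s : ℝ) : 𝓢(Plane, Spinor) →L[ℝ] 𝓢(Plane, Spinor) :=
  SchwartzMap.compSubConstCLM ℝ (-(s • planeVec i)) - ContinuousLinearMap.id ℝ _ - s • planeDeriv i

lemma translateRem_eq (i : Fin 2) (s : ℝ) (f : 𝓢(Plane, Spinor)) : translateRem i s f =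
    SchwartzMap.compSubConstCLM ℝ (-(s • planeVec i)) f - f - s • planeDeriv i f := rfl

lemma planeDeriv_translateRem (i j : Fin 2) (s : ℝ) (f : 𝓢(Plane, Spinor)) :
    planeDeriv j (translateRem i s f) = translateRem i s (planeDeriv j f) := by
  simp only [translateRem_eq, map_sub, map_smul, planeDeriv_compSubConstCLM, planeDeriv_comm j i]

/-- The mean value inequality applied twice; the factor 1/2 of Taylor's formula is not needed. -/
lemma norm_taylor_two_le {φ φ' φ'' : ℝ → Spinor} (h1 : ∀ t, HasDerivAt φ (φ' t) t)
    (h2 : ∀ t, HasDerivAt φ' (φ'' t) t) {s D : ℝ} (hD : ∀ t, |t| ≤ |s| → ‖φ'' t‖ ≤ D) :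
    ‖φ s - φ 0 - s • φ' 0‖ ≤ D * s ^ 2 := by
  have hconv : Convex ℝ (Icc (-|s|) |s|) := convex_Icc _ _
  have hs : s ∈ Icc (-|s|) |s| := abs_le.1 le_rfl
  have h0 : (0 : ℝ) ∈ Icc (-|s|) |s| := ⟨by simp, by simp⟩
  have a : ∀ t ∈ Icc (-|s|) |s|, ‖φ' t - φ' 0‖ ≤ D * |s| := fun t ht => by
    have := hconv.norm_image_sub_le_of_norm_hasDerivWithin_le (f := φ') (f' := φ'') (C := D)
      (fun x _ => (h2 x).hasDerivWithinAt) (fun x hx => hD x (abs_le.2 hx)) h0 ht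
    refine this.trans ?_
    have hD0 : 0 ≤ D := (norm_nonneg _).trans (hD s le_rfl)
    rw [sub_zero, Real.norm_eq_abs]
    exact mul_le_mul_of_nonneg_left (abs_le.2 ht) hD0
  have := hconv.norm_image_sub_le_of_norm_hasDerivWithin_le (f := fun t => φ t - t • φ' 0)
    (f' := fun t => φ' t - φ' 0) (C := D * |s|)
    (fun x _ => by
      have := (h1 x).fun_sub ((hasDerivAt_id x).smul_const (φ' 0))
      rw [one_smul] at this
      exact this.hasDerivWithinAt)
    a h0 hs
  simp only [zero_smul, sub_zero, Real.norm_eq_abs] at this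
  rw [sub_right_comm]
  calc _ ≤ _ := this
    _ = D * s ^ 2 := by rw [mul_assoc, ← sq, sq_abs]

lemma polyWeight_norm_translateRem_le (i : Fin 2) (K : ℕ) {s B : ℝ} (hs : |s| ≤ B)
    (f : 𝓢(Plane, Spinor)) (x : Plane) : polyWeight K x * ‖translateRem i s f x‖ ≤
      s ^ 2 * (Real.exp (2 * K * B) *
        SchwartzMap.seminorm ℝ 0 0 (mulCLM (polyWeight K) (planeDeriv i (planeDeriv i f)))) := by
  set Q := SchwartzMap.seminorm ℝ 0 0 (mulCLM (polyWeight K) (planeDeriv i (planeDeriv i f)))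
  have hp : ∀ t, HasDerivAt (fun t : ℝ => x + t • planeVec i) (planeVec i) t := fun t => by
    simpa using ((hasDerivAt_id t).smul_const (planeVec i)).const_add x
  have hd : ∀ (g : 𝓢(Plane, Spinor)) (t : ℝ),
      HasDerivAt (fun t : ℝ => g (x + t • planeVec i)) (planeDeriv i g (x + t • planeVec i)) t :=
    fun g t => (g.differentiableAt.hasFDerivAt).comp_hasDerivAt t (hp t)
  have hw := polyWeight_pos K x
  have hD : ∀ t : ℝ, |t| ≤ |s| → ‖planeDeriv i (planeDeriv i f) (x + t • planeVec i)‖ ≤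
      (polyWeight K x)⁻¹ * (Real.exp (2 * K * B) * Q) := by
    intro t ht
    set y := x + t • planeVec i with hy
    -- Along the segment the weight at x and at the shifted point are comparable, uniformly for |s|
    -- ≤ B.
    have h1 : polyWeight K x ≤ Real.exp (2 * K * B) * polyWeight K y := by
      have := polyWeight_add_le K y (-(t • planeVec i))
      rw [hy, add_neg_cancel_right, norm_neg, norm_smul] at this
      simp only [PiLp.norm_single, norm_one, mul_one, Real.norm_eq_abs] at this
      refine this.trans ?_
      rw [← hy]
      have := (polyWeight_pos K y).le
      have := ht.trans hs
      gcongr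
    have h2 : polyWeight K y * ‖planeDeriv i (planeDeriv i f) y‖ ≤ Q := by
      have := SchwartzMap.norm_le_seminorm ℝ (mulCLM (polyWeight K) (planeDeriv i (planeDeriv i f))) y
      rwa [mulCLM_apply (polyWeight_temperate K), norm_smul,
        Real.norm_of_nonneg (polyWeight_pos _ _).le] at this
    rw [inv_mul_eq_div, le_div_iff₀ hw]
    calc _ ≤ ‖planeDeriv i (planeDeriv i f) y‖ * (Real.exp (2 * K * B) * polyWeight K y) := by gcongr
      _ = Real.exp (2 * K * B) * (polyWeight K y * ‖planeDeriv i (planeDeriv i f) y‖) := by ring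
      _ ≤ _ := by gcongr
  have := norm_taylor_two_le (hd f) (hd (planeDeriv i f)) hD
  have e : translateRem i s f x = f (x + s • planeVec i) - f (x + (0 : ℝ) • planeVec i) -
      s • planeDeriv i f (x + (0 : ℝ) • planeVec i) := by
    rw [zero_smul, add_zero, translateRem_eq]
    change f (x - -(s • planeVec i)) - f x - s • planeDeriv i f x = _
    rw [sub_neg_eq_add]
  rw [e]
  calc _ ≤ polyWeight K x * ((polyWeight K x)⁻¹ * (Real.exp (2 * K * B) * Q) * s ^ 2) := by gcongr
    _ = _ := by field_simp

/-- Enough extra weight turns a pointwise bound into an L² bound, so the pointwise Taylor estimate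
yields consistency. -/
lemma sobNorm_zero_le_of_bound (M : ℕ) : ∃ (K : ℕ) (C : ℝ), 0 ≤ C ∧
    ∀ (f : 𝓢(Plane, Spinor)) (B : ℝ), 0 ≤ B → (∀ x, polyWeight K x * ‖f x‖ ≤ B) →
      sobNorm 0 M f ≤ C * B := by
  obtain ⟨k, C, hC, H⟩ := SchwartzMap.norm_toLp_le_seminorm ℝ (E := Plane) Spinor 2 volume
  refine ⟨M + k, C, hC, fun f B hB hf => ?_⟩
  rw [sobNorm_zero]
  refine (H _).trans ?_
  gcongr
  refine Seminorm.finset_sup_apply_le hB fun i hi => ?_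
  rw [Finset.mem_Iic, Prod.mk_le_mk] at hi
  obtain ⟨i1, i2⟩ := i
  obtain rfl : i2 = 0 := by simpa using hi.2
  refine SchwartzMap.seminorm_le_bound ℝ _ _ _ hB fun x => ?_
  rw [norm_iteratedFDeriv_zero, mulCLM_apply (polyWeight_temperate M), norm_smul,
    Real.norm_of_nonneg (polyWeight_pos _ _).le]
  refine le_trans ?_ (hf x)
  rw [← polyWeight_mul, ← mul_assoc, mul_comm (polyWeight M x)]
  have := (polyWeight_pos M x).le
  gcongr
  have h1 : ‖x‖ ^ i1 ≤ polyWeight i1 x := by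
    unfold polyWeight
    gcongr
    nlinarith [sq_nonneg (‖x‖ - 1)]
  refine h1.trans ?_
  unfold polyWeight
  exact pow_le_pow_right₀ (by nlinarith [sq_nonneg ‖x‖]) (by simpa using hi.1)

lemma sobNorm_translateRem_le (i : Fin 2) (B : ℝ) (k M : ℕ) :
    ∃ q' : Seminorm ℝ 𝓢(Plane, Spinor), Continuous q' ∧ ∀ s : ℝ, |s| ≤ B → ∀ f,
      sobNorm k M (translateRem i s f) ≤ s ^ 2 * q' f := by
  induction k with
  | zero =>
    obtain ⟨K, C, hC, H⟩ := sobNorm_zero_le_of_bound M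
    let q : Seminorm ℝ 𝓢(Plane, Spinor) := (SchwartzMap.seminorm ℝ 0 0).comp
      ((mulCLM (polyWeight K) ∘L planeDeriv i ∘L planeDeriv i : 𝓢(Plane, Spinor) →L[ℝ] 𝓢(Plane, Spinor)) :
        𝓢(Plane, Spinor) →ₗ[ℝ] 𝓢(Plane, Spinor))
    refine ⟨(C * Real.exp (2 * K * B)).toNNReal • q, ?_, fun s hs f => ?_⟩
    · rw [FunLike.coe_smul]
      exact (Seminorm.continuous_clm_comp (SchwartzMap.continuous_seminorm 0 0) _).const_smul _
    · have hq : 0 ≤ SchwartzMap.seminorm ℝ 0 0 (mulCLM (polyWeight K) (planeDeriv i (planeDeriv i f))) :=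
        apply_nonneg _ _
      refine (H _ _ (by positivity) (polyWeight_norm_translateRem_le i K hs f)).trans (le_of_eq ?_)
      rw [smul_apply, NNReal.smul_def, smul_eq_mul, Real.coe_toNNReal _ (by positivity)]
      change _ = s ^ 2 * (C * Real.exp (2 * K * B) *
        SchwartzMap.seminorm ℝ 0 0 (mulCLM (polyWeight K) (planeDeriv i (planeDeriv i f))))
      ring
  | succ k ih =>
    obtain ⟨q, hq, H⟩ := ih
    refine ⟨q + (q.comp (planeDeriv 0 : _ →ₗ[ℝ] _) + q.comp (planeDeriv 1 : _ →ₗ[ℝ] _)),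
      Seminorm.continuous_add hq (Seminorm.continuous_add (Seminorm.continuous_clm_comp hq _)
        (Seminorm.continuous_clm_comp hq _)), fun s hs f => ?_⟩
    rw [sobNorm_succ, planeDeriv_translateRem, planeDeriv_translateRem]
    change _ ≤ s ^ 2 * (q f + (q (planeDeriv 0 f) + q (planeDeriv 1 f)))
    linarith [H s hs f, H s hs (planeDeriv 0 f), H s hs (planeDeriv 1 f)]

end Transport

/-! ### The split scheme and forward solvability. -/

section Splitting

variable {A : Spinor →L[ℂ] Spinor}

/-- The generator `c A ∂_i` of a transport group. -/
def transportGen (A : Spinor →L[ℂ] Spinor) (c : ℝ) (i : Fin 2) :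
    𝓢(Plane, Spinor) →L[ℝ] 𝓢(Plane, Spinor) :=
  c • (SchwartzMap.postcompCLM (A.restrictScalars ℝ) ∘L planeDeriv i)

/-- One step of the transport group, as an endomorphism. -/
abbrev transportStep (A : Spinor →L[ℂ] Spinor) (c : ℝ) (i : Fin 2) (t : ℝ) :
    Module.End ℝ 𝓢(Plane, Spinor) := (transport A (planeVec i) (c * t) : _ →ₗ[ℝ] _)

lemma IsHermitianInvolution.sobNorm_transportStep_le (hA : IsHermitianInvolution A) (c : ℝ)
    (i : Fin 2) (k M : ℕ) : ∃ C : ℝ, 0 ≤ C ∧ ∀ t ∈ Icc (0 : ℝ) 1, ∀ g,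
      sobNorm k M (transportStep A c i t g) ≤ Real.exp (C * t) * sobNorm k M g := by
  refine ⟨2 * M * |c|, by positivity, fun t ht g => ?_⟩
  have := hA.sobNorm_transport_le (planeVec i) (c * t) k M g
  rw [norm_smul, norm_mul, Real.norm_of_nonneg ht.1] at this
  simpa [mul_assoc] using this

/-- Since P₊ + P₋ = 1 and P₊ - P₋ = A, the zeroth and first order terms recombine, leaving one
Taylor remainder per spectral component. -/
lemma transport_sub_sub (A : Spinor →L[ℂ] Spinor) (c : ℝ) (i : Fin 2) (t : ℝ) (g : 𝓢(Plane, Spinor)) :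
    transport A (planeVec i) (c * t) g - g - t • transportGen A c i g =
      SchwartzMap.postcompCLM (specProj A 1) (translateRem i (c * t) g) +
      SchwartzMap.postcompCLM (specProj A (-1)) (translateRem i (-(c * t)) g) := by
  ext1 x
  have h1 := specProj_add_specProj A (g x)
  have h2 := specProj_sub_specProj A (planeDeriv i g x)
  change specProj A 1 (g (x - -((c * t) • planeVec i))) + specProj A (-1) (g (x - (c * t) • planeVec i))
    - g x - t • (c • A (planeDeriv i g x)) =
    specProj A 1 (g (x - -((c * t) • planeVec i)) - g x - (c * t) • planeDeriv i g x) +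
    specProj A (-1) (g (x - -((-(c * t)) • planeVec i)) - g x - (-(c * t)) • planeDeriv i g x)
  rw [← h2, neg_smul (c * t) (planeVec i), neg_neg]
  conv_lhs => rw [← h1]
  simp only [map_sub, map_smul, smul_sub, neg_smul, smul_smul, mul_comm t c, map_neg]
  abel

lemma transportStep_isConsistent (A : Spinor →L[ℂ] Spinor) (c : ℝ) (i : Fin 2) :
    IsConsistent (transportStep A c i) (transportGen A c i) := by
  refine isConsistent_of_sobNorm_le fun k M => ?_
  obtain ⟨q, hq, H⟩ := sobNorm_translateRem_le i |c| k M
  obtain ⟨q', hq', H'⟩ := Seminorm.exists_weighted_sum (N := fun _ : Unit => q) (fun _ => hq)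
    (c := fun _ => c ^ 2 * (‖specProj A 1‖ + ‖specProj A (-1)‖)) (fun _ => by positivity)
    Finset.univ
  refine ⟨q', hq', fun t ht g => ?_⟩
  have hct : |c * t| ≤ |c| := by
    rw [abs_mul, abs_of_nonneg ht.1]
    exact mul_le_of_le_one_right (abs_nonneg c) ht.2
  have h1 := (sobNorm_postcompCLM_le (specProj A 1) k M (translateRem i (c * t) g)).trans
    (mul_le_mul_of_nonneg_left (H _ hct g) (norm_nonneg _))
  have h2 := (sobNorm_postcompCLM_le (specProj A (-1)) k M (translateRem i (-(c * t)) g)).trans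
    (mul_le_mul_of_nonneg_left (H _ ((abs_neg _).trans_le hct) g) (norm_nonneg _))
  change sobNorm k M (transport A (planeVec i) (c * t) g - g - t • transportGen A c i g) ≤ _
  rw [transport_sub_sub, H']
  refine (map_add_le_add _ _ _).trans ((add_le_add h1 h2).trans (le_of_eq ?_))
  simp only [Finset.univ_unique, Finset.sum_singleton]
  ring

/-- Multiplication by `κ` and a constant matrix. -/
def potentialGen (κ : Plane → ℝ) (B : Spinor →L[ℝ] Spinor) :
    𝓢(Plane, Spinor) →L[ℝ] 𝓢(Plane, Spinor) :=
  mulCLM κ ∘L SchwartzMap.postcompCLM B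

lemma potentialGen_apply {κ : Plane → ℝ} (hκ : IsSmoothBounded κ) (B : Spinor →L[ℝ] Spinor)
    (f : 𝓢(Plane, Spinor)) (x : Plane) : potentialGen κ B f x = κ x • B (f x) :=
  mulCLM_apply hκ.temperate _ x

/-- The explicit Euler step of a bounded operator. -/
abbrev eulerStep (G : 𝓢(Plane, Spinor) →L[ℝ] 𝓢(Plane, Spinor)) (t : ℝ) :
    Module.End ℝ 𝓢(Plane, Spinor) := 1 + t • (G : _ →ₗ[ℝ] _)

lemma eulerStep_isConsistent (G : 𝓢(Plane, Spinor) →L[ℝ] 𝓢(Plane, Spinor)) :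
    IsConsistent (eulerStep G) G := by
  refine fun q _ => ⟨0, continuous_const, fun t _ g => ?_⟩
  have : eulerStep G t g - g - t • G g = 0 := by
    change g + t • G g - g - t • G g = 0
    abel
  rw [this]; simp

lemma sobNorm_eulerStep_potential_le {κ : Plane → ℝ} (hκ : IsSmoothBounded κ)
    (B : Spinor →L[ℝ] Spinor) (k M : ℕ) : ∃ C : ℝ, 0 ≤ C ∧ ∀ t ∈ Icc (0 : ℝ) 1, ∀ g,
      sobNorm k M (eulerStep (potentialGen κ B) t g) ≤ Real.exp (C * t) * sobNorm k M g := by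
  obtain ⟨C, hC, H⟩ := sobNorm_mulCLM_le hκ k M
  refine ⟨C * ‖B‖, by positivity, fun t ht g => ?_⟩
  change sobNorm k M (g + t • mulCLM κ (SchwartzMap.postcompCLM B g)) ≤ _
  refine (map_add_le_add _ _ _).trans ?_
  rw [map_smul_eq_mul, Real.norm_of_nonneg ht.1]
  have ht0 := ht.1
  have hg : 0 ≤ sobNorm k M g := apply_nonneg _ _
  calc _ ≤ sobNorm k M g + t * (C * (‖B‖ * sobNorm k M g)) := by
        gcongr
        exact (H _).trans (by gcongr; exact sobNorm_postcompCLM_le B k M g)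
    _ = (C * ‖B‖ * t + 1) * sobNorm k M g := by ring
    _ ≤ _ := by gcongr; exact Real.add_one_le_exp _

lemma sobNorm_mul_le {S₁ S₂ : ℝ → Module.End ℝ 𝓢(Plane, Spinor)} {k M : ℕ}
    (h₁ : ∃ C : ℝ, 0 ≤ C ∧ ∀ t ∈ Icc (0 : ℝ) 1, ∀ g,
      sobNorm k M (S₁ t g) ≤ Real.exp (C * t) * sobNorm k M g)
    (h₂ : ∃ C : ℝ, 0 ≤ C ∧ ∀ t ∈ Icc (0 : ℝ) 1, ∀ g,
      sobNorm k M (S₂ t g) ≤ Real.exp (C * t) * sobNorm k M g) :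
    ∃ C : ℝ, 0 ≤ C ∧ ∀ t ∈ Icc (0 : ℝ) 1, ∀ g,
      sobNorm k M ((S₁ t * S₂ t) g) ≤ Real.exp (C * t) * sobNorm k M g := by
  obtain ⟨C₁, hC₁, H₁⟩ := h₁
  obtain ⟨C₂, hC₂, H₂⟩ := h₂
  refine ⟨C₁ + C₂, by positivity, fun t ht g => ?_⟩
  rw [add_mul, Real.exp_add, mul_assoc, Module.End.mul_apply]
  exact (H₁ t ht _).trans (by gcongr; exact H₂ t ht g)

variable {A₀ A₁ : Spinor →L[ℂ] Spinor}

/-- The generator of a symmetric hyperbolic system with a bounded potential. -/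
def hyperbolicGen (A₀ A₁ : Spinor →L[ℂ] Spinor) (c : ℝ) (κ : Plane → ℝ) (B : Spinor →L[ℝ] Spinor) :
    𝓢(Plane, Spinor) →L[ℝ] 𝓢(Plane, Spinor) :=
  transportGen A₀ c 0 + (transportGen A₁ c 1 + potentialGen κ B)

lemma hyperbolicGen_apply (A₀ A₁ : Spinor →L[ℂ] Spinor) (c : ℝ) {κ : Plane → ℝ}
    (hκ : IsSmoothBounded κ) (B : Spinor →L[ℝ] Spinor) (f : 𝓢(Plane, Spinor)) (x : Plane) :
    hyperbolicGen A₀ A₁ c κ B f x = c • A₀ (fderiv ℝ f x (planeVec 0)) +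
      (c • A₁ (fderiv ℝ f x (planeVec 1)) + κ x • B (f x)) := by
  rw [← potentialGen_apply hκ]; rfl

/-- The Cauchy problem of the system is solvable forward in time in the Schwartz space. -/
theorem exists_forward_solution (h₀ : IsHermitianInvolution A₀) (h₁ : IsHermitianInvolution A₁)
    (c : ℝ) {κ : Plane → ℝ} (hκ : IsSmoothBounded κ) (B : Spinor →L[ℝ] Spinor)
    (f : 𝓢(Plane, Spinor)) :
    ∃ α : ℝ → 𝓢(Plane, Spinor), α 0 = f ∧
      ∀ q : Seminorm ℝ 𝓢(Plane, Spinor), Continuous q → ∀ ρ, 0 ≤ ρ → ∃ C : ℝ, 0 ≤ C ∧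
        ∀ T T', 0 ≤ T → T ≤ T' → T' ≤ ρ →
          q (α T' - α T - (T' - T) • hyperbolicGen A₀ A₁ c κ B (α T)) ≤ C * (T' - T) ^ 2 := by
  have s₀ := h₀.sobNorm_transportStep_le c 0
  have s₁ := h₁.sobNorm_transportStep_le c 1
  have s₂ := sobNorm_eulerStep_potential_le hκ B
  have hcons := (transportStep_isConsistent A₀ c 0).comp
    ((transportStep_isConsistent A₁ c 1).comp (eulerStep_isConsistent (potentialGen κ B))
      (isStable_of_sobNorm_le s₁)) (isStable_of_sobNorm_le s₀)
  exact hcons.exists_solution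
    (isStable_of_sobNorm_le fun k M => sobNorm_mul_le (s₀ k M) (sobNorm_mul_le (s₁ k M) (s₂ k M)))
    SchwartzMap.exists_tendsto_sum f

end Splitting

/-! ### Solution curves on the whole line and joint smoothness. -/

section Flow

variable {V : Type*} [AddCommGroup V] [Module ℝ V] [TopologicalSpace V]

/-- `α` solves `α' = G α` on `[0, ∞)`, in the sense of forward second order expansions. -/
def IsForwardSolution (G : V →L[ℝ] V) (α : ℝ → V) : Prop :=
  ∀ q : Seminorm ℝ V, Continuous q → ∀ ρ, 0 ≤ ρ → ∃ C : ℝ, 0 ≤ C ∧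
    ∀ T T', 0 ≤ T → T ≤ T' → T' ≤ ρ → q (α T' - α T - (T' - T) • G (α T)) ≤ C * (T' - T) ^ 2

variable {G : V →L[ℝ] V} {α : ℝ → V}

lemma IsForwardSolution.bounded (h : IsForwardSolution G α) {q : Seminorm ℝ V} (hq : Continuous q)
    {ρ : ℝ} (hρ : 0 ≤ ρ) : ∃ B : ℝ, 0 ≤ B ∧ ∀ T ∈ Icc 0 ρ, q (α T) ≤ B := by
  obtain ⟨C, hC, H⟩ := h q hq ρ hρ
  have n0 : 0 ≤ q (α 0) := apply_nonneg _ _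
  have n1 : 0 ≤ q (G (α 0)) := apply_nonneg _ _
  refine ⟨C * ρ ^ 2 + (q (α 0) + ρ * q (G (α 0))), by positivity, fun T hT => ?_⟩
  have h1 := H 0 T le_rfl hT.1 hT.2
  have e : α T = (α T - α 0 - (T - 0) • G (α 0)) + (α 0 + T • G (α 0)) := by
    rw [sub_zero]; abel
  have h2 := map_add_le_add q (α T - α 0 - (T - 0) • G (α 0)) (α 0 + T • G (α 0))
  have h3 := map_add_le_add q (α 0) (T • G (α 0))
  rw [map_smul_eq_mul, Real.norm_of_nonneg hT.1] at h3
  rw [← e] at h2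
  rw [sub_zero] at h1 h2
  have h4 : T ^ 2 ≤ ρ ^ 2 := pow_le_pow_left₀ hT.1 hT.2 2
  nlinarith [mul_le_mul_of_nonneg_right hT.2 n1, mul_le_mul_of_nonneg_left h4 hC]

/-- For T' ≤ T, expand forward from T' and replace G α(T') by G α(T); their difference is O(T - T')
by the forward expansion and boundedness. -/
lemma IsForwardSolution.two_sided (h : IsForwardSolution G α) {q : Seminorm ℝ V} (hq : Continuous q)
    {ρ : ℝ} (hρ : 0 ≤ ρ) : ∃ C : ℝ, 0 ≤ C ∧ ∀ T ∈ Icc 0 ρ, ∀ T' ∈ Icc 0 ρ,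
      q (α T' - α T - (T' - T) • G (α T)) ≤ C * (T' - T) ^ 2 := by
  have hr := Seminorm.continuous_clm_comp hq G
  obtain ⟨C, hC, H⟩ := h q hq ρ hρ
  obtain ⟨D, hD, HD⟩ := h _ hr ρ hρ
  obtain ⟨B, hB, HB⟩ := h.bounded (Seminorm.continuous_clm_comp hr G) hρ
  refine ⟨C + D * ρ + B, by positivity, fun T hT T' hT' => ?_⟩
  rcases le_total T T' with hle | hle
  · refine (H T T' hT.1 hle hT'.2).trans ?_
    have : 0 ≤ D * ρ + B := by positivity
    nlinarith [sq_nonneg (T' - T)]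
  · set d := T - T' with hd
    have hd0 : 0 ≤ d := sub_nonneg.2 hle
    have hdρ : d ≤ ρ := by linarith [hT.2, hT'.1]
    have e : α T' - α T - (T' - T) • G (α T) =
        d • G (α T - α T') - (α T - α T' - d • G (α T')) := by
      rw [← neg_sub T T', ← hd, neg_smul, map_sub, smul_sub]; abel
    have h1 := H T' T hT'.1 hle hT.2
    have h2 := HD T' T hT'.1 hle hT.2
    have h3 := HB T' hT'
    rw [← hd] at h1 h2
    simp only [Seminorm.comp_apply, ContinuousLinearMap.coe_coe] at h2 h3
    have e2 : G (α T - α T') = G (α T - α T' - d • G (α T')) + d • G (G (α T')) := by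
      simp only [map_sub, map_smul]; abel
    have h4 := map_add_le_add q (G (α T - α T' - d • G (α T'))) (d • G (G (α T')))
    rw [← e2, map_smul_eq_mul, Real.norm_of_nonneg hd0] at h4
    have h5 := map_sub_le_add q (d • G (α T - α T')) (α T - α T' - d • G (α T'))
    rw [← e, map_smul_eq_mul, Real.norm_of_nonneg hd0] at h5
    have e3 : (T' - T) ^ 2 = d ^ 2 := by rw [hd]; ring
    rw [e3]
    have h6 : q (G (α T - α T')) ≤ (D * ρ + B) * d := by
      nlinarith [mul_le_mul_of_nonneg_left h3 hd0,
        mul_le_mul_of_nonneg_left hdρ (mul_nonneg hD hd0)]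
    nlinarith [mul_le_mul_of_nonneg_left h6 hd0]

lemma IsForwardSolution.hasDerivWithinAt {W : Type*} [NormedAddCommGroup W] [NormedSpace ℝ W]
    (h : IsForwardSolution G α) (Q : V →L[ℝ] W) {T : ℝ} (hT : 0 ≤ T) :
    HasDerivWithinAt (fun t => Q (α t)) (Q (G (α T))) (Ici 0) T := by
  have hq : Continuous ((normSeminorm ℝ W).comp (Q : V →ₗ[ℝ] W)) := Q.continuous.norm
  obtain ⟨C, hC, H⟩ := h.two_sided hq (by positivity : 0 ≤ T + 1)
  rw [hasDerivWithinAt_iff_isLittleO]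
  refine Asymptotics.IsBigO.trans_isLittleO (g := fun t => ‖t - T‖ ^ 2) ?_
    ((Asymptotics.isLittleO_pow_sub_sub T one_lt_two).mono nhdsWithin_le_nhds)
  refine Asymptotics.IsBigO.of_bound C ?_
  filter_upwards [self_mem_nhdsWithin, mem_nhdsWithin_of_mem_nhds (Iio_mem_nhds (lt_add_one T))]
    with t ht0 ht1
  have := H T ⟨hT, by linarith⟩ t ⟨ht0, le_of_lt ht1⟩
  simp only [Seminorm.comp_apply, ContinuousLinearMap.coe_coe, map_sub, map_smul,
    coe_normSeminorm] at this
  simpa using this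

/-- `α` solves `α' = G α` on the real line, tested against continuous linear maps into normed
spaces. -/
def IsSolutionCurve (G : V →L[ℝ] V) (α : ℝ → V) : Prop :=
  ∀ {W : Type} [NormedAddCommGroup W] [NormedSpace ℝ W] (Q : V →L[ℝ] W) (T : ℝ),
    HasDerivAt (fun t => Q (α t)) (Q (G (α T))) T

/-- The backward branch is a forward solution for -G run in reverse. At time 0 the two one-sided
derivatives agree, so two-sided calculus is available there too. -/
lemma IsForwardSolution.glue {G' : V →L[ℝ] V} (hG : ∀ f, G' f = -G f) {β : ℝ → V}
    (hα : IsForwardSolution G α) (hβ : IsForwardSolution G' β) (h0 : α 0 = β 0) :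
    IsSolutionCurve G fun t => if 0 ≤ t then α t else β (-t) := by
  intro W _ _ Q T
  set γ : ℝ → V := fun t => if 0 ≤ t then α t else β (-t) with hγ
  have p : ∀ t, 0 ≤ t → γ t = α t := fun t ht => if_pos ht
  have n : ∀ t, t ≤ 0 → γ t = β (-t) := fun t ht => by
    rcases ht.lt_or_eq with h | rfl
    · exact if_neg (not_le.2 h)
    · simp [hγ, h0]
  have hp : 0 ≤ T → HasDerivWithinAt (fun t => Q (γ t)) (Q (G (γ T))) (Ici 0) T := fun hT => by
    rw [p T hT]
    exact (hα.hasDerivWithinAt Q hT).congr (fun t ht => by rw [p t ht]) (by rw [p T hT])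
  have hn : T ≤ 0 → HasDerivWithinAt (fun t => Q (γ t)) (Q (G (γ T))) (Iic 0) T := fun hT => by
    have h1 := (hβ.hasDerivWithinAt Q (neg_nonneg.2 hT)).scomp T (h := fun t : ℝ => -t) (s := Iic 0)
      (hasDerivAt_neg T).hasDerivWithinAt (fun t (ht : t ≤ 0) => neg_nonneg.2 ht)
    have e : (-1 : ℝ) • Q (G' (β (-T))) = Q (G (γ T)) := by
      rw [n T hT, hG, map_neg, smul_neg, neg_smul, one_smul, neg_neg]
    rw [e] at h1
    exact h1.congr (fun t ht => by rw [n t ht]; rfl) (by rw [n T hT]; rfl)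
  rcases lt_trichotomy T 0 with h | h | h
  · exact (hn h.le).hasDerivAt (Iic_mem_nhds h)
  · have := (hp h.ge).union (hn h.le)
    rwa [Ici_union_Iic, hasDerivWithinAt_univ] at this
  · exact (hp h.le).hasDerivAt (Ici_mem_nhds h)

theorem exists_solutionCurve {A₀ A₁ : Spinor →L[ℂ] Spinor} (h₀ : IsHermitianInvolution A₀)
    (h₁ : IsHermitianInvolution A₁) (c : ℝ) {κ : Plane → ℝ} (hκ : IsSmoothBounded κ)
    (B : Spinor →L[ℝ] Spinor) (f : 𝓢(Plane, Spinor)) :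
    ∃ α : ℝ → 𝓢(Plane, Spinor), α 0 = f ∧ IsSolutionCurve (hyperbolicGen A₀ A₁ c κ B) α := by
  obtain ⟨α, hα0, hα⟩ := exists_forward_solution h₀ h₁ c hκ B f
  -- Reversing time replaces (c, B) by (-c, -B), a system of the same type.
  obtain ⟨β, hβ0, hβ⟩ := exists_forward_solution h₀ h₁ (-c) hκ (-B) f
  refine ⟨_, ?_, IsForwardSolution.glue (G := hyperbolicGen A₀ A₁ c κ B) (α := α)
    (fun g => ?_) hα hβ (hα0.trans hβ0.symm)⟩
  · simp [hα0]
  · ext1 x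
    rw [neg_apply, hyperbolicGen_apply _ _ _ hκ, hyperbolicGen_apply _ _ _ hκ, neg_apply]
    module

variable {H : 𝓢(Plane, Spinor) →L[ℝ] 𝓢(Plane, Spinor)} {γ : ℝ → 𝓢(Plane, Spinor)}

/-- Evaluation of a Schwartz function at a point. -/
def evalAt (x : Plane) : 𝓢(Plane, Spinor) →L[ℝ] Spinor :=
  BoundedContinuousFunction.evalCLM ℝ x ∘L SchwartzMap.toBoundedContinuousFunctionCLM ℝ Plane Spinor

lemma IsSolutionCurve.hasDerivAt_apply (h : IsSolutionCurve H γ)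
    (Q : 𝓢(Plane, Spinor) →L[ℝ] 𝓢(Plane, Spinor)) (T : ℝ) (x : Plane) :
    HasDerivAt (fun t => Q (γ t) x) (Q (H (γ T)) x) T := h (evalAt x ∘L Q) T

lemma IsSolutionCurve.continuous_apply (h : IsSolutionCurve H γ)
    (Q : 𝓢(Plane, Spinor) →L[ℝ] 𝓢(Plane, Spinor)) :
    Continuous fun p : ℝ × Plane => Q (γ p.1) p.2 := by
  have hb : Continuous fun t => SchwartzMap.toBoundedContinuousFunctionCLM ℝ Plane Spinor (Q (γ t)) :=
    continuous_iff_continuousAt.2 fun t => (h (SchwartzMap.toBoundedContinuousFunctionCLM ℝ Plane Spinor ∘L Q) t).continuousAt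
  exact continuous_eval.comp ((hb.comp continuous_fst).prodMk continuous_snd)

lemma fderiv_eq_smulRight (f : 𝓢(Plane, Spinor)) (y : Plane) : fderiv ℝ f y =
    (EuclideanSpace.proj 0 : Plane →L[ℝ] ℝ).smulRight (planeDeriv 0 f y) +
    (EuclideanSpace.proj 1 : Plane →L[ℝ] ℝ).smulRight (planeDeriv 1 f y) := by
  ext1 v
  have hv : v = v 0 • planeVec 0 + v 1 • planeVec 1 := by
    ext i; fin_cases i <;> simp
  conv_lhs => rw [hv]
  simp only [map_add, map_smul, add_apply]
  rfl

/-- The joint derivative in time and space. -/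
def jointDeriv (H Q : 𝓢(Plane, Spinor) →L[ℝ] 𝓢(Plane, Spinor)) (γ : ℝ → 𝓢(Plane, Spinor))
    (p : ℝ × Plane) : ℝ × Plane →L[ℝ] Spinor :=
  (ContinuousLinearMap.toSpanSingleton ℝ (Q (H (γ p.1)) p.2)).coprod (fderiv ℝ (Q (γ p.1)) p.2)

/-- The partial derivatives in time and space exist everywhere and are jointly continuous. -/
lemma IsSolutionCurve.hasFDerivAt (h : IsSolutionCurve H γ)
    (Q : 𝓢(Plane, Spinor) →L[ℝ] 𝓢(Plane, Spinor)) (p : ℝ × Plane) :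
    HasFDerivAt (fun p : ℝ × Plane => Q (γ p.1) p.2) (jointDeriv H Q γ p) p := by
  have c₁ : Continuous fun p : ℝ × Plane =>
      ContinuousLinearMap.toSpanSingleton ℝ (Q (H (γ p.1)) p.2) := by
    have e : (fun p : ℝ × Plane => ContinuousLinearMap.toSpanSingleton ℝ (Q (H (γ p.1)) p.2)) =
        fun p => (ContinuousLinearMap.id ℝ ℝ).smulRight ((Q ∘L H) (γ p.1) p.2) := by
      funext p; ext; simp
    rw [e]
    exact ((ContinuousLinearMap.smulRightL ℝ ℝ Spinor _).continuous).comp (h.continuous_apply (Q ∘L H))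
  have c₂ : Continuous fun p : ℝ × Plane => fderiv ℝ (Q (γ p.1)) p.2 := by
    simp only [fderiv_eq_smulRight]
    exact (((ContinuousLinearMap.smulRightL ℝ Plane Spinor _).continuous).comp
      (h.continuous_apply (planeDeriv 0 ∘L Q))).add
      (((ContinuousLinearMap.smulRightL ℝ Plane Spinor _).continuous).comp
      (h.continuous_apply (planeDeriv 1 ∘L Q)))
  exact (hasStrictFDerivAt_uncurry_coprod (𝕜 := ℝ) (u := p) (f := fun t x => Q (γ t) x)
    (f₁ := fun t x => ContinuousLinearMap.toSpanSingleton ℝ (Q (H (γ t)) x))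
    (f₂ := fun t x => fderiv ℝ (Q (γ t)) x)
    (Filter.Eventually.of_forall fun v => (h.hasDerivAt_apply Q v.1 v.2).hasFDerivAt)
    (Filter.Eventually.of_forall fun v => (Q (γ v.1)).hasFDerivAt v.2)
    c₁.continuousAt c₂.continuousAt).hasFDerivAt

/-- Q is arbitrary so that the induction closes: the partial derivatives of Q γ are again of this
form, with Q ∘ H in time and ∂_j ∘ Q in space. -/
lemma IsSolutionCurve.contDiff (h : IsSolutionCurve H γ) (n : ℕ)
    (Q : 𝓢(Plane, Spinor) →L[ℝ] 𝓢(Plane, Spinor)) :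
    ContDiff ℝ n fun p : ℝ × Plane => Q (γ p.1) p.2 := by
  induction n generalizing Q with
  | zero => exact contDiff_zero.2 (h.continuous_apply Q)
  | succ n ih =>
    have hf : fderiv ℝ (fun p : ℝ × Plane => Q (γ p.1) p.2) = jointDeriv H Q γ :=
      funext fun p => (h.hasFDerivAt Q p).fderiv
    push_cast
    rw [contDiff_succ_iff_fderiv]
    refine ⟨fun p => (h.hasFDerivAt Q p).differentiableAt, by simp, ?_⟩
    rw [hf]
    have e : jointDeriv H Q γ = fun p =>
        (ContinuousLinearMap.fst ℝ ℝ Plane).smulRight ((Q ∘L H) (γ p.1) p.2) +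
        (((EuclideanSpace.proj 0 : Plane →L[ℝ] ℝ) ∘L ContinuousLinearMap.snd ℝ ℝ Plane).smulRight
          ((planeDeriv 0 ∘L Q) (γ p.1) p.2) +
        ((EuclideanSpace.proj 1 : Plane →L[ℝ] ℝ) ∘L ContinuousLinearMap.snd ℝ ℝ Plane).smulRight
          ((planeDeriv 1 ∘L Q) (γ p.1) p.2)) := by
      funext p
      unfold jointDeriv
      rw [fderiv_eq_smulRight]
      ext v <;> simp
    rw [e]
    exact (contDiff_const.smulRight (ih _)).add ((contDiff_const.smulRight (ih _)).add
      (contDiff_const.smulRight (ih _)))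

end Flow

/-! ### Time derivatives, weighted bounds and Sobolev regularity. -/

section Regularity

variable {H : 𝓢(Plane, Spinor) →L[ℝ] 𝓢(Plane, Spinor)} {γ : ℝ → 𝓢(Plane, Spinor)}

lemma IsSolutionCurve.isClassCk (h : IsSolutionCurve H γ) (I : Set ℝ) :
    IsClassCk ∞ I fun t => γ t :=
  (contDiff_infty.2 fun n => h.contDiff n (ContinuousLinearMap.id ℝ _)).contDiffOn

lemma IsSolutionCurve.iteratedDerivWithin_eq {W : Type} [NormedAddCommGroup W] [NormedSpace ℝ W]
    (h : IsSolutionCurve H γ) (P : Spinor →L[ℝ] W) (l : ℕ) {T : ℝ} (hT : 0 ≤ T) (X : Plane) :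
    iteratedDerivWithin l (fun t => P (γ t X)) (Ici 0) T = P ((H ^ l) (γ T) X) := by
  induction l generalizing T with
  | zero => simp
  | succ l ih =>
    rw [iteratedDerivWithin_succ, derivWithin_congr (s := Ici 0)
      (f := fun t => P ((H ^ l) (γ t) X)) (fun t ht => ih ht) (ih hT)]
    have h1 := h (P ∘L evalAt X ∘L (H ^ l)) T
    rw [pow_succ]
    exact h1.hasDerivWithinAt.derivWithin (uniqueDiffOn_Ici 0 T hT)

lemma spacePartial_eq_planeDeriv (j : Fin 2) (g : 𝓢(Plane, Spinor)) :
    spacePartial j g = planeDeriv j g :=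
  funext fun x => (SchwartzMap.lineDerivOp_apply (planeVec j) g x).symm

lemma spacePartials_eq_planeDeriv (n : Fin 2 → ℕ) (g : 𝓢(Plane, Spinor)) :
    spacePartials n g = ((planeDeriv 0 ^ n 0) ((planeDeriv 1 ^ n 1) g) : 𝓢(Plane, Spinor)) := by
  have h : ∀ (j : Fin 2) (k : ℕ) (g : 𝓢(Plane, Spinor)),
      (spacePartial j)^[k] g = ((planeDeriv j ^ k) g : 𝓢(Plane, Spinor)) := by
    intro j k g
    induction k generalizing g with
    | zero => rfl
    | succ k ih =>
      rw [Function.iterate_succ_apply, spacePartial_eq_planeDeriv, ih, pow_succ]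
      rfl
  rw [spacePartials, h, h]

/-- Q γ is a continuous curve in the sup norm, hence bounded on the compact interval. -/
lemma IsSolutionCurve.exists_bound (h : IsSolutionCurve H γ)
    (Q : 𝓢(Plane, Spinor) →L[ℝ] 𝓢(Plane, Spinor)) (ρ : ℝ) :
    ∃ C : ℝ, 0 < C ∧ ∀ T ∈ Icc 0 ρ, ∀ X, ‖Q (γ T) X‖ ≤ C := by
  have hb : Continuous fun t => SchwartzMap.toBoundedContinuousFunctionCLM ℝ Plane Spinor (Q (γ t)) :=
    continuous_iff_continuousAt.2 fun t =>
      (h (SchwartzMap.toBoundedContinuousFunctionCLM ℝ Plane Spinor ∘L Q) t).continuousAt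
  obtain ⟨C, hC⟩ := isCompact_Icc.exists_bound_of_continuousOn (s := Icc 0 ρ) hb.continuousOn
  refine ⟨max C 1, by positivity, fun T hT X => ?_⟩
  refine le_trans ?_ ((hC T hT).trans (le_max_left _ _))
  exact BoundedContinuousFunction.norm_coe_le_norm
    (SchwartzMap.toBoundedContinuousFunctionCLM ℝ Plane Spinor (Q (γ T))) X

lemma IsSolutionCurve.weighted_bound (h : IsSolutionCurve H γ) (ρ : ℝ) (l M : ℕ) (n : Fin 2 → ℕ) :
    ∃ C : ℝ, 0 < C ∧ ∀ T ∈ Icc 0 ρ, ∀ X : Plane, (1 + ‖X‖ ^ 2) ^ ((M : ℝ) / 2) *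
      ‖spacePartials n (fun Y => iteratedDerivWithin l (fun t => γ t Y) (Ici 0) T) X‖ ≤ C := by
  obtain ⟨C, hC, hb⟩ := h.exists_bound
    (mulCLM (polyWeight M) ∘L (planeDeriv 0 ^ n 0) ∘L (planeDeriv 1 ^ n 1) ∘L (H ^ l)) ρ
  refine ⟨C, hC, fun T hT X => ?_⟩
  refine le_trans ?_ (hb T hT X)
  have e : (fun Y => iteratedDerivWithin l (fun t => γ t Y) (Ici 0) T) = ((H ^ l) (γ T)) :=
    funext fun Y => h.iteratedDerivWithin_eq (ContinuousLinearMap.id ℝ Spinor) l hT.1 Y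
  rw [e, spacePartials_eq_planeDeriv]
  simp only [ContinuousLinearMap.comp_apply]
  rw [mulCLM_apply (polyWeight_temperate M), norm_smul, Real.norm_of_nonneg (polyWeight_pos _ _).le]
  gcongr
  -- The base 1 + |X|² is at least 1, so the polynomial weight with exponent M dominates the one
  -- with M/2.
  have hM : (M : ℝ) / 2 ≤ M := half_le_self (Nat.cast_nonneg M)
  calc (1 + ‖X‖ ^ 2) ^ ((M : ℝ) / 2) ≤ (1 + ‖X‖ ^ 2) ^ (M : ℝ) :=
        Real.rpow_le_rpow_of_exponent_le (le_add_of_nonneg_right (sq_nonneg _)) hM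
    _ = polyWeight M X := Real.rpow_natCast _ _

/-- The Bessel potential of a Schwartz function, as an element of `L²`. -/
def besselLp (s : ℝ) : 𝓢(Plane, Spinor) →L[ℝ] Lp Spinor 2 (volume : Measure Plane) :=
  SchwartzMap.toLpCLM ℝ Spinor 2 volume ∘L
    SchwartzMap.fourierMultiplierCLM Spinor (fun x : Plane => ((1 + ‖x‖ ^ 2) ^ (s / 2) : ℝ))

lemma besselPotential_toLp (s : ℝ) (g : 𝓢(Plane, Spinor)) :
    TemperedDistribution.besselPotential Plane Spinor s (Lp.toTemperedDistribution (g.toLp 2)) =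
      Lp.toTemperedDistribution (besselLp s g) := by
  have e : besselLp s g = (SchwartzMap.fourierMultiplierCLM Spinor
    (fun x : Plane => ((1 + ‖x‖ ^ 2) ^ (s / 2) : ℝ)) g).toLp 2 := rfl
  rw [e, TemperedDistribution.besselPotential, Lp.toTemperedDistribution_toLp_eq,
    TemperedDistribution.fourierMultiplierCLM_toTemperedDistributionCLM_eq (by fun_prop),
    Lp.toTemperedDistribution_toLp_eq]
  congr 1
  exact SchwartzMap.fourierMultiplierCLM_ofReal ℂ
    (Function.hasTemperateGrowth_one_add_norm_sq_rpow Plane (s / 2)) g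

/-- The Bessel potential into L² is one more admissible Q, so the curve is C¹ into H^s for every
real s. -/
lemma IsSolutionCurve.isSobolevCurve (h : IsSolutionCurve H γ) {k : WithTop ℕ∞} (hk : k ≤ 1) (s : ℝ)
    (I : Set ℝ) : IsSobolevCurve k s I fun t => γ t := by
  refine ⟨fun t => besselLp s (γ t), ?_, fun T _ => ⟨(γ T).memLp 2, besselPotential_toLp s (γ T)⟩⟩
  refine (ContDiff.of_le ?_ hk).contDiffOn
  rw [contDiff_one_iff_deriv]
  refine ⟨fun t => (h (besselLp s) t).differentiableAt, ?_⟩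
  have e : deriv (fun t => besselLp s (γ t)) = fun t => (besselLp s ∘L H) (γ t) :=
    funext fun t => (h (besselLp s) t).deriv
  rw [e]
  exact continuous_iff_continuousAt.2 fun t => (h (besselLp s ∘L H) t).continuousAt

end Regularity

/-! ### The Dirac system as a symmetric hyperbolic system. -/

section Dirac

/-- The first Pauli matrix. -/
def pauliOne : Spinor →L[ℂ] Spinor :=
  LinearMap.toContinuousLinearMap
    { toFun := fun u => !₂[u 1, u 0]
      map_add' := fun u v => by ext i; fin_cases i <;> simp
      map_smul' := fun a u => by ext i; fin_cases i <;> simp }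

/-- The negative of the second Pauli matrix. -/
def pauliTwo : Spinor →L[ℂ] Spinor :=
  LinearMap.toContinuousLinearMap
    { toFun := fun u => !₂[Complex.I * u 1, -Complex.I * u 0]
      map_add' := fun u v => by ext i; fin_cases i <;> simp <;> ring
      map_smul' := fun a u => by ext i; fin_cases i <;> simp <;> ring }

/-- The third Pauli matrix. -/
def pauliThree : Spinor →L[ℂ] Spinor :=
  LinearMap.toContinuousLinearMap
    { toFun := fun u => !₂[u 0, -u 1]
      map_add' := fun u v => by ext i; fin_cases i <;> simp; ring
      map_smul' := fun a u => by ext i; fin_cases i <;> simp }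

@[simp] lemma pauliOne_zero (u : Spinor) : pauliOne u 0 = u 1 := rfl
@[simp] lemma pauliOne_one (u : Spinor) : pauliOne u 1 = u 0 := rfl
@[simp] lemma pauliTwo_zero (u : Spinor) : pauliTwo u 0 = Complex.I * u 1 := rfl
@[simp] lemma pauliTwo_one (u : Spinor) : pauliTwo u 1 = -Complex.I * u 0 := rfl
@[simp] lemma pauliThree_zero (u : Spinor) : pauliThree u 0 = u 0 := rfl
@[simp] lemma pauliThree_one (u : Spinor) : pauliThree u 1 = -u 1 := rfl

lemma pauliOne_isHermitianInvolution : IsHermitianInvolution pauliOne where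
  symm u v := by simp [PiLp.inner_apply, Fin.sum_univ_two, add_comm]
  invol u := by ext i; fin_cases i <;> simp

lemma pauliTwo_isHermitianInvolution : IsHermitianInvolution pauliTwo where
  symm u v := by simp [PiLp.inner_apply, Fin.sum_univ_two]; ring
  invol u := by ext i; fin_cases i <;> simp [← mul_assoc]

/-- The mass term `i m σ₃`. -/
def massTerm (m : ℝ) : Spinor →L[ℝ] Spinor :=
  m • (Complex.I • pauliThree).restrictScalars ℝ

lemma massTerm_apply (m : ℝ) (u : Spinor) : massTerm m u = m • Complex.I • pauliThree u := rfl

/-- The generator of the Dirac evolution. -/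
abbrev diracGen (E v ϑ : ℝ) (κ : Plane → ℝ) : 𝓢(Plane, Spinor) →L[ℝ] 𝓢(Plane, Spinor) :=
  hyperbolicGen pauliOne pauliTwo (v / (2 * √E)) κ (massTerm (ϑ / (2 * √E)))

lemma spacePartial_component (j i : Fin 2) {f : Plane → Spinor} {X : Plane}
    (hf : DifferentiableAt ℝ f X) :
    spacePartial j (fun Y => f Y i) X = fderiv ℝ f X (planeVec j) i := by
  have h1 : HasFDerivAt (fun Y => f Y i)
      ((EuclideanSpace.proj i : Spinor →L[ℂ] ℂ).restrictScalars ℝ ∘L fderiv ℝ f X) X :=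
    ((EuclideanSpace.proj i : Spinor →L[ℂ] ℂ).restrictScalars ℝ).hasFDerivAt.comp X hf.hasFDerivAt
  exact (h1.hasLineDerivAt (planeVec j)).lineDeriv

/-- The Dirac system in vector form. -/
lemma dirac_system_iff {c m k : ℝ} {w d₀ d₁ u : Spinor} :
    w = c • pauliOne d₀ + (c • pauliTwo d₁ + k • massTerm m u) ↔
      (Complex.I * w 0 - (c : ℂ) * (Complex.I * d₀ 1 - d₁ 1) + ((m * k : ℝ) : ℂ) * u 0 = 0) ∧
      (Complex.I * w 1 - (c : ℂ) * (Complex.I * d₀ 0 + d₁ 0) - ((m * k : ℝ) : ℂ) * u 1 = 0) := by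
  have hI := Complex.I_mul_I
  constructor
  · rintro rfl
    simp only [massTerm_apply, PiLp.add_apply, PiLp.smul_apply, pauliOne_zero, pauliOne_one,
      pauliTwo_zero, pauliTwo_one, pauliThree_zero, pauliThree_one, Complex.real_smul, smul_eq_mul,
      Complex.ofReal_mul]
    constructor
    · linear_combination (c * d₁ 1 + k * m * u 0) * hI
    · linear_combination (-c * d₁ 0 - k * m * u 1) * hI
  · rintro ⟨h1, h2⟩
    ext i
    fin_cases i <;>
    simp only [massTerm_apply, PiLp.add_apply, PiLp.smul_apply, pauliOne_zero, pauliOne_one,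
      pauliTwo_zero, pauliTwo_one, pauliThree_zero, pauliThree_one, Complex.real_smul, smul_eq_mul,
      Complex.ofReal_mul, Fin.zero_eta, Fin.mk_one] at h1 h2 ⊢
    · linear_combination (-Complex.I) * h1 + (w 0 - c * d₀ 1) * hI
    · linear_combination (-Complex.I) * h2 + (w 1 - c * d₀ 0) * hI

/-- The initial spinor field. -/
def initialSpinor (α₁₀ α₂₀ : 𝓢(Plane, ℂ)) : 𝓢(Plane, Spinor) :=
  SchwartzMap.postcompCLM (ContinuousLinearMap.toSpanSingleton ℂ (EuclideanSpace.single 0 1)) α₁₀ +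
  SchwartzMap.postcompCLM (ContinuousLinearMap.toSpanSingleton ℂ (EuclideanSpace.single 1 1)) α₂₀

lemma initialSpinor_apply (α₁₀ α₂₀ : 𝓢(Plane, ℂ)) (X : Plane) : initialSpinor α₁₀ α₂₀ X =
    α₁₀ X • EuclideanSpace.single 0 1 + α₂₀ X • EuclideanSpace.single 1 1 := rfl

lemma IsSolutionCurve.solvesDirac {E v ϑ : ℝ} {κ : Plane → ℝ} (hκ : IsSmoothBounded κ)
    {γ : ℝ → 𝓢(Plane, Spinor)} (h : IsSolutionCurve (diracGen E v ϑ κ) γ) {α₁₀ α₂₀ : 𝓢(Plane, ℂ)}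
    (h0 : γ 0 = initialSpinor α₁₀ α₂₀) :
    SolvesDirac E v ϑ κ α₁₀ α₂₀ (Ici 0) fun t => γ t := by
  have key : ∀ T ∈ Ici (0 : ℝ), ∀ X : Plane, _ := fun T hT X => dirac_system_iff.1
    (hyperbolicGen_apply pauliOne pauliTwo (v / (2 * √E)) hκ (massTerm (ϑ / (2 * √E))) (γ T) X)
  have hd : ∀ T ∈ Ici (0 : ℝ), ∀ (X : Plane) (i : Fin 2),
      derivWithin (fun t => γ t X i) (Ici 0) T = diracGen E v ϑ κ (γ T) X i := fun T hT X i =>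
    (h ((EuclideanSpace.proj i : Spinor →L[ℂ] ℂ).restrictScalars ℝ ∘L evalAt X) T).hasDerivWithinAt.derivWithin
      (uniqueDiffOn_Ici 0 T hT)
  refine ⟨fun T hT X => ?_, fun T hT X => ?_, fun X => ?_, fun X => ?_⟩
  · rw [hd T hT, spacePartial_component _ _ (γ T).differentiableAt,
      spacePartial_component _ _ (γ T).differentiableAt, mul_div_right_comm]
    exact (key T hT X).1
  · rw [hd T hT, spacePartial_component _ _ (γ T).differentiableAt,
      spacePartial_component _ _ (γ T).differentiableAt, mul_div_right_comm]
    exact (key T hT X).2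
  · simp [h0, initialSpinor_apply]
  · simp [h0, initialSpinor_apply]

end Dirac

/-! ### Energy decay in backward cones. -/

section Energy

lemma integral_fderiv_eq_zero_of_hasCompactSupport {g : Plane → ℝ} (hg : ContDiff ℝ 1 g)
    (hs : HasCompactSupport g) (v : Plane) : ∫ x, fderiv ℝ g x v = 0 := by
  have hc : Continuous fun x => fderiv ℝ g x v := (hg.continuous_fderiv (by simp)).clm_apply continuous_const
  have hcs : HasCompactSupport fun x => fderiv ℝ g x v := hs.fderiv_apply ℝ v
  have := integral_mul_fderiv_eq_neg_fderiv_mul_of_integrable (μ := (volume : Measure Plane))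
    (f := fun _ => (1 : ℝ)) (g := g) (v := v) (by simp)
    (by simpa using hc.integrable_of_hasCompactSupport hcs)
    (by simpa using hg.continuous.integrable_of_hasCompactSupport hs)
    (fun x _ => differentiableAt_const _) (fun x _ => hg.differentiable (by simp) x)
  simpa using this

lemma hasDerivAt_slice {F : ℝ → Plane → ℝ} {a b : ℝ}
    (hF : ContDiffOn ℝ 1 (fun p : ℝ × Plane => F p.1 p.2) (Ioo a b ×ˢ univ)) {T : ℝ}
    (hT : T ∈ Ioo a b) (X : Plane) :
    HasDerivAt (fun t => F t X) (fderiv ℝ (fun p : ℝ × Plane => F p.1 p.2) (T, X) (1, 0)) T := by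
  have ho : IsOpen (Ioo a b ×ˢ (univ : Set Plane)) := isOpen_Ioo.prod isOpen_univ
  have hm : ((T, X) : ℝ × Plane) ∈ Ioo a b ×ˢ (univ : Set Plane) := ⟨hT, mem_univ X⟩
  have h := ((hF.contDiffAt (ho.mem_nhds hm)).differentiableAt (by simp)).hasFDerivAt
  exact h.comp_hasDerivAt T ((hasDerivAt_id T).prodMk (hasDerivAt_const T X))

lemma continuousOn_timeDeriv {F : ℝ → Plane → ℝ} {a b : ℝ}
    (hF : ContDiffOn ℝ 1 (fun p : ℝ × Plane => F p.1 p.2) (Ioo a b ×ˢ univ)) :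
    ContinuousOn (fun p : ℝ × Plane => fderiv ℝ (fun p : ℝ × Plane => F p.1 p.2) p (1, 0))
      (Ioo a b ×ˢ univ) :=
  (hF.continuousOn_fderiv_of_isOpen (isOpen_Ioo.prod isOpen_univ) (by simp)).clm_apply
    continuousOn_const

/-- Differentiation under the integral sign for functions with compact support in space. -/
lemma hasDerivAt_integral_of_compact {F : ℝ → Plane → ℝ} {a b : ℝ} {K : Set Plane}
    (hF : ContDiffOn ℝ 1 (fun p : ℝ × Plane => F p.1 p.2) (Ioo a b ×ˢ univ)) (hK : IsCompact K)
    (hz : ∀ t ∈ Ioo a b, ∀ X ∉ K, F t X = 0) {T : ℝ} (hT : T ∈ Ioo a b) :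
    Integrable (fun X => fderiv ℝ (fun p : ℝ × Plane => F p.1 p.2) (T, X) (1, 0)) ∧
    HasDerivAt (fun t => ∫ X, F t X)
      (∫ X, fderiv ℝ (fun p : ℝ × Plane => F p.1 p.2) (T, X) (1, 0)) T := by
  set F' : ℝ → Plane → ℝ := fun t X => fderiv ℝ (fun p : ℝ × Plane => F p.1 p.2) (t, X) (1, 0)
  -- Off K the function vanishes at all nearby times, hence so does its time derivative. On K,
  -- shrinking to a compact time interval gives a uniform bound, so a multiple of the indicator of K
  -- dominates.
  have hF'z : ∀ t ∈ Ioo a b, ∀ X ∉ K, F' t X = 0 := fun t ht X hX => by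
    refine (hasDerivAt_slice hF ht X).unique ((hasDerivAt_const t (0 : ℝ)).congr_of_eventuallyEq ?_)
    filter_upwards [Ioo_mem_nhds ht.1 ht.2] with s hs using hz s hs X hX
  obtain ⟨a', ha'⟩ := exists_between hT.1
  obtain ⟨b', hb'⟩ := exists_between hT.2
  have hsub : Icc a' b' ⊆ Ioo a b := fun t ht => ⟨ha'.1.trans_le ht.1, ht.2.trans_lt hb'.2⟩
  obtain ⟨C, hC⟩ := (isCompact_Icc.prod hK).exists_bound_of_continuousOn (s := Icc a' b' ×ˢ K)
    ((continuousOn_timeDeriv hF).mono (prod_mono hsub (subset_univ K)))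
  have hcF : ∀ t ∈ Ioo a b, Continuous (F t) := fun t ht =>
    continuousOn_univ.1 (hF.continuousOn.comp (f := fun X : Plane => (t, X)) (by fun_prop)
      fun X _ => ⟨ht, mem_univ X⟩)
  have hcF' : Continuous (F' T) :=
    continuousOn_univ.1 ((continuousOn_timeDeriv hF).comp (f := fun X : Plane => (T, X)) (by fun_prop)
      fun X _ => ⟨hT, mem_univ X⟩)
  refine hasDerivAt_integral_of_dominated_loc_of_deriv_le (F := F) (F' := F')
    (s := Ioo a' b') (bound := K.indicator fun _ => C)
    (Ioo_mem_nhds ha'.2 hb'.1) ?_ ?_ hcF'.aestronglyMeasurable ?_ ?_ ?_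
  · filter_upwards [Ioo_mem_nhds hT.1 hT.2] with t ht using (hcF t ht).aestronglyMeasurable
  · exact (hcF T hT).integrable_of_hasCompactSupport
      (HasCompactSupport.intro hK fun X hX => hz T hT X hX)
  · refine Filter.Eventually.of_forall fun X t ht => ?_
    by_cases hX : X ∈ K
    · rw [indicator_of_mem hX]
      exact hC (t, X) ⟨Ioo_subset_Icc_self ht, hX⟩
    · rw [indicator_of_notMem hX, hF'z t (hsub (Ioo_subset_Icc_self ht)) X hX, norm_zero]
  · exact (integrable_indicator_iff hK.measurableSet).2 (integrableOn_const hK.measure_lt_top.ne)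
  · exact Filter.Eventually.of_forall fun X t ht =>
      hasDerivAt_slice hF (hsub (Ioo_subset_Icc_self ht)) X

/-- A smoothed distance to the point `X₀`. -/
def smoothDist (X₀ X : Plane) : ℝ := √(1 + ‖X - X₀‖ ^ 2)

lemma contDiff_smoothDist (X₀ : Plane) : ContDiff ℝ 1 (smoothDist X₀) := by
  refine ContDiff.sqrt ?_ fun X => by positivity
  exact contDiff_const.add ((contDiff_id.sub contDiff_const).norm_sq ℝ)

/-- The smoothed distance is 1-Lipschitz, so the slope l alone governs the opening of the cone. -/
lemma abs_fderiv_smoothDist_le (X₀ X v : Plane) : |fderiv ℝ (smoothDist X₀) X v| ≤ ‖v‖ := by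
  have h1 : HasFDerivAt (fun Y : Plane => 1 + ‖Y - X₀‖ ^ 2) _ X :=
    (((hasFDerivAt_id X).sub_const X₀).norm_sq).const_add 1
  have h0 : (0 : ℝ) < 1 + ‖X - X₀‖ ^ 2 := by positivity
  have h2 := (h1.sqrt h0.ne').fderiv
  change |fderiv ℝ (fun Y : Plane => √(1 + ‖Y - X₀‖ ^ 2)) X v| ≤ ‖v‖
  rw [h2]
  have hs : 0 < √(1 + ‖X - X₀‖ ^ 2) := Real.sqrt_pos.2 h0
  have h3 : ‖X - X₀‖ ≤ √(1 + ‖X - X₀‖ ^ 2) := Real.le_sqrt_of_sq_le (by linarith)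
  have h4 := abs_real_inner_le_norm (X - X₀) v
  have e : ((1 / (2 * √(1 + ‖X - X₀‖ ^ 2))) • (2 • (innerSL ℝ (id X - X₀)).comp
      (ContinuousLinearMap.id ℝ Plane))) v = inner ℝ (X - X₀) v / √(1 + ‖X - X₀‖ ^ 2) := by
    simp [inner_sub_left]
    field_simp
  refine (congrArg abs e).trans_le ?_
  rw [abs_div, abs_of_pos hs, div_le_iff₀ hs]
  nlinarith [norm_nonneg v]

lemma norm_sub_le_smoothDist (X₀ X : Plane) : ‖X - X₀‖ ≤ smoothDist X₀ X :=
  Real.le_sqrt_of_sq_le (by linarith)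

lemma deriv_expNegInvGlue_nonneg (x : ℝ) : 0 ≤ deriv expNegInvGlue x :=
  expNegInvGlue.monotone.deriv_nonneg

/-- The cutoff, supported in a backward cone. -/
def coneCutoff (X₀ : Plane) (R l : ℝ) (t : ℝ) (X : Plane) : ℝ :=
  expNegInvGlue (R - smoothDist X₀ X - l * t)

lemma contDiff_coneCutoff (X₀ : Plane) (R l : ℝ) :
    ContDiff ℝ 1 fun p : ℝ × Plane => coneCutoff X₀ R l p.1 p.2 :=
  expNegInvGlue.contDiff.comp ((contDiff_const.sub ((contDiff_smoothDist X₀).comp contDiff_snd)).sub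
    (contDiff_const.mul contDiff_fst))

lemma coneCutoff_nonneg (X₀ : Plane) (R l t : ℝ) (X : Plane) : 0 ≤ coneCutoff X₀ R l t X :=
  expNegInvGlue.nonneg _

lemma coneCutoff_eq_zero {X₀ : Plane} {R l t : ℝ} (hl : 0 ≤ l) (ht : 0 ≤ t) {X : Plane}
    (hX : X ∉ Metric.closedBall X₀ R) : coneCutoff X₀ R l t X = 0 := by
  refine expNegInvGlue.zero_of_nonpos ?_
  rw [Metric.mem_closedBall, not_le, dist_eq_norm] at hX
  have := norm_sub_le_smoothDist X₀ X
  have := mul_nonneg hl ht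
  linarith

lemma coneCutoff_hasDerivAt (X₀ : Plane) (R l t : ℝ) (X : Plane) :
    HasDerivAt (fun t => coneCutoff X₀ R l t X)
      (deriv expNegInvGlue (R - smoothDist X₀ X - l * t) * -l) t := by
  have h : HasDerivAt (fun t => R - smoothDist X₀ X - l * t) (-l) t := by
    simpa using ((hasDerivAt_id t).const_mul l).const_sub (R - smoothDist X₀ X)
  exact ((expNegInvGlue.contDiff (n := 1)).differentiable (by simp) _).hasDerivAt.comp t h

lemma coneCutoff_hasFDerivAt (X₀ : Plane) (R l t : ℝ) (X : Plane) :
    HasFDerivAt (coneCutoff X₀ R l t)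
      (deriv expNegInvGlue (R - smoothDist X₀ X - l * t) • -fderiv ℝ (smoothDist X₀) X) X := by
  have h : HasFDerivAt (fun X => R - smoothDist X₀ X - l * t) (-fderiv ℝ (smoothDist X₀) X) X :=
    (((contDiff_smoothDist X₀).differentiable (by simp) X).hasFDerivAt.const_sub R).sub_const _
  exact ((expNegInvGlue.contDiff (n := 1)).differentiable (by simp) _).hasDerivAt.comp_hasFDerivAt X h

/-- The symmetry of the coefficients that makes the energy decay in backward cones. -/
structure IsEnergyCoeff (A : Spinor →L[ℝ] Spinor) : Prop where
  symm : ∀ u v, inner ℝ (A u) v = inner ℝ u (A v)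
  norm_le : ∀ u, ‖A u‖ ≤ ‖u‖

/-- The flux `φ ⟨u, A u⟩` and its divergence. -/
lemma IsEnergyCoeff.fderiv_flux {A : Spinor →L[ℝ] Spinor} (hA : IsEnergyCoeff A) {φ : Plane → ℝ}
    {φ' : Plane →L[ℝ] ℝ} {u : Plane → Spinor} {X : Plane} (hφ : HasFDerivAt φ φ' X)
    (hu : DifferentiableAt ℝ u X) (v : Plane) :
    fderiv ℝ (fun Y => φ Y * inner ℝ (u Y) (A (u Y))) X v =
      φ' v * inner ℝ (u X) (A (u X)) + φ X * (2 * inner ℝ (u X) (A (fderiv ℝ u X v))) := by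
  have h1 : HasFDerivAt (fun Y => A (u Y)) (A ∘L fderiv ℝ u X) X :=
    A.hasFDerivAt.comp X hu.hasFDerivAt
  have h2 := hu.hasFDerivAt.inner ℝ h1
  have h3 : inner ℝ (fderiv ℝ u X v) (A (u X)) = inner ℝ (u X) (A (fderiv ℝ u X v)) := by
    rw [← hA.symm, real_inner_comm]
  refine (congrArg (fun L : Plane →L[ℝ] ℝ => L v) (hφ.mul h2).fderiv).trans ?_
  simp only [add_apply, smul_apply, smul_eq_mul, ContinuousLinearMap.comp_apply,
    ContinuousLinearMap.prod_apply, fderivInnerCLM_apply, h3]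
  ring

variable {A₀ A₁ B : Spinor →L[ℝ] Spinor} {c : ℝ} {κ : Plane → ℝ}

/-- A `C¹` solution of a symmetric hyperbolic system with vanishing initial values vanishes. -/
theorem eq_zero_of_solution (h₀ : IsEnergyCoeff A₀) (h₁ : IsEnergyCoeff A₁)
    (hB : ∀ u, inner ℝ u (B u) = 0) {d : ℝ → Plane → Spinor} {τ : ℝ} (hτ : 0 < τ)
    (hd : ContDiffOn ℝ 1 (fun p : ℝ × Plane => d p.1 p.2) (Icc 0 τ ×ˢ univ))
    (heq : ∀ T ∈ Ioo 0 τ, ∀ X, HasDerivAt (fun t => d t X)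
      (c • A₀ (fderiv ℝ (d T) X (planeVec 0)) +
        (c • A₁ (fderiv ℝ (d T) X (planeVec 1)) + κ X • B (d T X))) T)
    (hinit : ∀ X, d 0 X = 0) (X₀ : Plane) : d τ X₀ = 0 := by
  -- Each of the two fluxes contributes at most |c| ‖u‖² times the slope of the cutoff.
  set l : ℝ := 2 * |c| with hl
  have hl0 : 0 ≤ l := by positivity
  -- The smoothed distance is 1 at its centre, so the cutoff's argument at (τ, X₀) is R - 1 - l τ =
  -- 1 > 0.
  set R : ℝ := 2 + l * τ with hR
  set φ := coneCutoff X₀ R l with hφ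
  set K := Metric.closedBall X₀ R with hK
  have hKc : IsCompact K := isCompact_closedBall _ _
  have hzero : ∀ t ∈ Icc 0 τ, ∀ X ∉ K, φ t X = 0 := fun t ht X hX => coneCutoff_eq_zero hl0 ht.1 hX
  let F : ℝ → Plane → ℝ := fun t X => φ t X * ‖d t X‖ ^ 2
  have hF : ContDiffOn ℝ 1 (fun p : ℝ × Plane => F p.1 p.2) (Icc 0 τ ×ˢ univ) :=
    (contDiff_coneCutoff X₀ R l).contDiffOn.mul (hd.norm_sq ℝ)
  have hFo := hF.mono (prod_mono Ioo_subset_Icc_self (subset_univ (univ : Set Plane)))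
  have hFz : ∀ t ∈ Icc 0 τ, ∀ X ∉ K, F t X = 0 := fun t ht X hX => by
    simp [F, hzero t ht X hX]
  have hslice : ∀ T ∈ Icc 0 τ, ContDiff ℝ 1 (d T) := fun T hT =>
    contDiffOn_univ.1 (hd.comp (f := fun X : Plane => (T, X)) (by fun_prop) fun X _ => ⟨hT, mem_univ X⟩)
  have hder := fun T (hT : T ∈ Ioo 0 τ) => hasDerivAt_integral_of_compact hFo hKc
    (fun t ht => hFz t (Ioo_subset_Icc_self ht)) hT
  have hnonpos : ∀ T ∈ Ioo 0 τ,
      ∫ X, fderiv ℝ (fun p : ℝ × Plane => F p.1 p.2) (T, X) (1, 0) ≤ 0 := by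
    intro T hT
    have hTI := Ioo_subset_Icc_self hT
    have hφT : ContDiff ℝ 1 (φ T) :=
      (contDiff_coneCutoff X₀ R l).comp (f := fun X : Plane => (T, X)) (by fun_prop)
    have flux : ∀ A : Spinor →L[ℝ] Spinor, ∀ v : Plane,
        Integrable (fun X => fderiv ℝ (fun Y => φ T Y * inner ℝ (d T Y) (A (d T Y))) X v) ∧
        ∫ X, fderiv ℝ (fun Y => φ T Y * inner ℝ (d T Y) (A (d T Y))) X v = 0 := by
      intro A v
      have hg : ContDiff ℝ 1 fun Y => φ T Y * inner ℝ (d T Y) (A (d T Y)) :=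
        hφT.mul ((hslice T hTI).inner ℝ (A.contDiff.comp (hslice T hTI)))
      have hs : HasCompactSupport fun Y => φ T Y * inner ℝ (d T Y) (A (d T Y)) :=
        HasCompactSupport.intro hKc fun X hX => by simp [hzero T hTI X hX]
      exact ⟨((hg.continuous_fderiv (by simp)).clm_apply continuous_const).integrable_of_hasCompactSupport
        (hs.fderiv_apply ℝ v), integral_fderiv_eq_zero_of_hasCompactSupport hg hs v⟩
    have i0 := flux A₀ (planeVec 0)
    have i1 := flux A₁ (planeVec 1)
    -- The potential term vanishes by skewness. The rest is the divergence of the fluxes up to terms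
    -- from differentiating the cutoff, which its decrease in time at rate l dominates.
    have hle : ∀ X, fderiv ℝ (fun p : ℝ × Plane => F p.1 p.2) (T, X) (1, 0) ≤
        c * fderiv ℝ (fun Y => φ T Y * inner ℝ (d T Y) (A₀ (d T Y))) X (planeVec 0) +
        c * fderiv ℝ (fun Y => φ T Y * inner ℝ (d T Y) (A₁ (d T Y))) X (planeVec 1) := by
      intro X
      have hdX := (hslice T hTI).differentiable (by simp) X
      have e := (hasDerivAt_slice hFo hT X).unique
        ((coneCutoff_hasDerivAt X₀ R l T X).mul (heq T hT X).norm_sq)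
      rw [e, h₀.fderiv_flux (coneCutoff_hasFDerivAt X₀ R l T X) hdX,
        h₁.fderiv_flux (coneCutoff_hasFDerivAt X₀ R l T X) hdX]
      have hp := deriv_expNegInvGlue_nonneg (R - smoothDist X₀ X - l * T)
      set p := deriv expNegInvGlue (R - smoothDist X₀ X - l * T)
      set u := d T X with hu
      have hbd : ∀ A, IsEnergyCoeff A → ∀ i, |c * (fderiv ℝ (smoothDist X₀) X (planeVec i) *
          inner ℝ u (A u))| ≤ |c| * ‖u‖ ^ 2 := by
        intro A hA i
        have b1 := abs_fderiv_smoothDist_le X₀ X (planeVec i)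
        rw [PiLp.norm_single, norm_one] at b1
        have b2 : |inner ℝ u (A u)| ≤ ‖u‖ ^ 2 := by
          refine (abs_real_inner_le_norm _ _).trans ?_
          rw [sq]; gcongr; exact hA.norm_le u
        rw [abs_mul, abs_mul]
        gcongr
        exact (mul_le_mul b1 b2 (abs_nonneg _) zero_le_one).trans_eq (one_mul _)
      have k0 := mul_le_mul_of_nonneg_left ((le_abs_self _).trans (hbd A₀ h₀ 0)) hp
      have k1 := mul_le_mul_of_nonneg_left ((le_abs_self _).trans (hbd A₁ h₁ 1)) hp
      simp only [inner_add_right, inner_smul_right, hB, smul_apply, neg_apply, smul_eq_mul, mul_zero,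
        add_zero]
      rw [hl]
      linarith
    calc _ ≤ ∫ X, (c * fderiv ℝ (fun Y => φ T Y * inner ℝ (d T Y) (A₀ (d T Y))) X (planeVec 0) +
        c * fderiv ℝ (fun Y => φ T Y * inner ℝ (d T Y) (A₁ (d T Y))) X (planeVec 1)) :=
        integral_mono (hder T hT).1 ((i0.1.const_mul c).add (i1.1.const_mul c)) hle
      _ = 0 := by
        rw [integral_add (i0.1.const_mul c) (i1.1.const_mul c), integral_const_mul,
          integral_const_mul, i0.2, i1.2]
        simp
  have hcont : ContinuousOn (fun t => ∫ X, F t X) (Icc 0 τ) :=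
    continuousOn_integral_of_compact_support hKc hF.continuousOn fun t X ht hX => hFz t ht X hX
  have hanti : AntitoneOn (fun t => ∫ X, F t X) (Icc 0 τ) := by
    refine antitoneOn_of_deriv_nonpos (convex_Icc 0 τ) hcont ?_ ?_
    · rw [interior_Icc]
      exact fun T hT => (hder T hT).2.differentiableAt.differentiableWithinAt
    · rw [interior_Icc]
      exact fun T hT => (hder T hT).2.deriv.trans_le (hnonpos T hT)
  have hend : ∫ X, F τ X ≤ 0 := by
    have := hanti (left_mem_Icc.2 hτ.le) (right_mem_Icc.2 hτ.le) hτ.le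
    simpa [F, hinit] using this
  -- The integrand at time τ is continuous and nonnegative; if it were nonzero at X₀ its integral
  -- would be positive.
  by_contra hne
  have hFc : Continuous (F τ) := continuousOn_univ.1
    (hF.continuousOn.comp (f := fun X : Plane => (τ, X)) (by fun_prop)
      fun X _ => ⟨right_mem_Icc.2 hτ.le, mem_univ X⟩)
  have hpos := hFc.integral_pos_of_hasCompactSupport_nonneg_nonzero (μ := volume) (x := X₀)
    (HasCompactSupport.intro hKc fun X hX => hFz τ (right_mem_Icc.2 hτ.le) X hX)
    (fun X => mul_nonneg (coneCutoff_nonneg _ _ _ _ _) (sq_nonneg _)) ?_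
  · linarith
  · have h1 : 0 < φ τ X₀ := by
      refine expNegInvGlue.pos_of_pos ?_
      simp only [smoothDist, hR, sub_self, norm_zero]
      norm_num
      linarith
    have h2 : 0 < ‖d τ X₀‖ := norm_pos_iff.2 hne
    exact (mul_pos h1 (pow_pos h2 2)).ne'

end Energy

/-! ### Uniqueness of C¹ solutions of the Dirac system. -/

section Uniqueness

lemma spinor_real_inner_eq (u v : Spinor) : inner ℝ u v = (inner ℂ u v).re := by
  simp [PiLp.inner_apply, Complex.inner]

lemma IsHermitianInvolution.isEnergyCoeff {A : Spinor →L[ℂ] Spinor} (hA : IsHermitianInvolution A) :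
    IsEnergyCoeff (A.restrictScalars ℝ) where
  symm u v := by
    rw [spinor_real_inner_eq, spinor_real_inner_eq]
    exact congrArg Complex.re (hA.symm u v)
  norm_le u := by
    refine le_of_eq ?_
    have h : (inner ℂ (A u) (A u)).re = (inner ℂ u u).re := by rw [hA.symm, hA.invol]
    rw [← spinor_real_inner_eq, ← spinor_real_inner_eq, real_inner_self_eq_norm_sq,
      real_inner_self_eq_norm_sq] at h
    exact (pow_left_inj₀ (norm_nonneg _) (norm_nonneg _) two_ne_zero).1 h

/-- The matrix σ₃ is Hermitian, so i m σ₃ is skew-adjoint and the mass term does not change the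
energy. -/
lemma real_inner_massTerm (m : ℝ) (u : Spinor) : inner ℝ u (massTerm m u) = 0 := by
  rw [massTerm_apply, inner_smul_right, spinor_real_inner_eq]
  simp [PiLp.inner_apply, Fin.sum_univ_two]
  right
  ring

variable {E v ϑ : ℝ} {κ : Plane → ℝ} {α₁₀ α₂₀ : 𝓢(Plane, ℂ)}

/-- A `C¹` solution of the Dirac system satisfies the system in vector form at interior times. -/
lemma SolvesDirac.hasDerivAt {I : Set ℝ} {β : ℝ → Plane → Spinor} (hβ : IsClassCk 1 I β)
    (h : SolvesDirac E v ϑ κ α₁₀ α₂₀ I β) {T : ℝ} (hT : I ∈ nhds T) (X : Plane) :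
    DifferentiableAt ℝ (β T) X ∧ HasDerivAt (fun t => β t X)
      ((v / (2 * √E)) • pauliOne (fderiv ℝ (β T) X (planeVec 0)) +
        ((v / (2 * √E)) • pauliTwo (fderiv ℝ (β T) X (planeVec 1)) +
          κ X • massTerm (ϑ / (2 * √E)) (β T X))) T := by
  have hTI := mem_of_mem_nhds hT
  have hm : I ×ˢ (univ : Set Plane) ∈ nhds ((T, X) : ℝ × Plane) := prod_mem_nhds hT Filter.univ_mem
  have hD := (hβ.contDiffAt hm).differentiableAt (by simp)
  have hx : DifferentiableAt ℝ (β T) X :=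
    hD.comp X (f := fun Y : Plane => (T, Y)) (by fun_prop)
  have ht : DifferentiableAt ℝ (fun t => β t X) T :=
    hD.comp T (f := fun t : ℝ => (t, X)) (by fun_prop)
  refine ⟨hx, ?_⟩
  have hw : ∀ i, derivWithin (fun t => β t X i) I T = deriv (fun t => β t X) T i := fun i => by
    rw [derivWithin_of_mem_nhds hT]
    exact (((EuclideanSpace.proj i : Spinor →L[ℂ] ℂ).restrictScalars ℝ).hasFDerivAt.comp_hasDerivAt T
      ht.hasDerivAt).deriv
  have e1 := h.eq_one T hTI X
  have e2 := h.eq_two T hTI X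
  rw [hw, spacePartial_component _ _ hx, spacePartial_component _ _ hx, mul_div_right_comm] at e1 e2
  rw [← dirac_system_iff.2 ⟨e1, e2⟩]
  exact ht.hasDerivAt

/-- `C¹` solutions of the Dirac system are determined by their initial values. -/
theorem SolvesDirac.unique {I : Set ℝ} (hI : ∀ T ∈ I, Icc 0 T ⊆ I) (hI0 : I ⊆ Ici 0)
    {β β' : ℝ → Plane → Spinor} (hβ : IsClassCk 1 I β) (hβ' : IsClassCk 1 I β')
    (h : SolvesDirac E v ϑ κ α₁₀ α₂₀ I β) (h' : SolvesDirac E v ϑ κ α₁₀ α₂₀ I β')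
    {T : ℝ} (hT : T ∈ I) (X : Plane) : β T X = β' T X := by
  have h0 : ∀ X, β 0 X - β' 0 X = 0 := fun X => by
    ext i
    fin_cases i
    · simp [h.init_one, h'.init_one]
    · simp [h.init_two, h'.init_two]
  rcases (show (0 : ℝ) ≤ T from hI0 hT).eq_or_lt with h00 | hpos
  · obtain rfl : 0 = T := h00
    exact sub_eq_zero.1 (h0 X)
  refine sub_eq_zero.1 (eq_zero_of_solution (d := fun t X => β t X - β' t X)
    pauliOne_isHermitianInvolution.isEnergyCoeff pauliTwo_isHermitianInvolution.isEnergyCoeff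
    (real_inner_massTerm (ϑ / (2 * √E))) (c := v / (2 * √E)) (κ := κ) hpos
    ((hβ.sub hβ').mono (prod_mono (hI T hT) (subset_univ _))) (fun t ht Y => ?_) h0 X)
  -- The energy argument uses the equation at interior times only, where one-sided derivatives are
  -- ordinary ones.
  have hmem : I ∈ nhds t := Filter.mem_of_superset (Icc_mem_nhds ht.1 ht.2) (hI T hT)
  obtain ⟨d1, e1⟩ := h.hasDerivAt hβ hmem Y
  obtain ⟨d2, e2⟩ := h'.hasDerivAt hβ' hmem Y
  have hf : fderiv ℝ (fun Y => β t Y - β' t Y) Y = fderiv ℝ (β t) Y - fderiv ℝ (β' t) Y :=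
    fderiv_sub d1 d2
  rw [hf]
  refine (e1.fun_sub e2).congr_deriv ?_
  simp only [sub_apply, map_sub, ContinuousLinearMap.coe_restrictScalars']
  module

/-- Needed for bounded intervals: at the right end point the derivative within the smaller interval
must agree with the one within the larger. -/
lemma SolvesDirac.mono {I J : Set ℝ} {β : ℝ → Plane → Spinor} (hβ : IsClassCk 1 J β)
    (h : SolvesDirac E v ϑ κ α₁₀ α₂₀ J β) (hIJ : I ⊆ J) (hI : UniqueDiffOn ℝ I) :
    SolvesDirac E v ϑ κ α₁₀ α₂₀ I β := by
  have hd : ∀ T ∈ I, ∀ X i, derivWithin (fun t => β t X i) I T = derivWithin (fun t => β t X i) J T := by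
    intro T hT X i
    refine derivWithin_subset hIJ (hI T hT) ?_
    have h1 : DifferentiableWithinAt ℝ (fun t => β t X) J T :=
      ((hβ.differentiableOn (by simp)) (T, X) ⟨hIJ hT, mem_univ X⟩).comp T
        (f := fun t : ℝ => (t, X)) (by fun_prop) fun t ht => ⟨ht, mem_univ X⟩
    exact ((EuclideanSpace.proj i : Spinor →L[ℂ] ℂ).restrictScalars ℝ).differentiableAt.comp_differentiableWithinAt T h1
  exact ⟨fun T hT X => by rw [hd T hT]; exact h.eq_one T (hIJ hT) X,
    fun T hT X => by rw [hd T hT]; exact h.eq_two T (hIJ hT) X, h.init_one, h.init_two⟩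

end Uniqueness

end

/-! ### Assembly of existence, uniqueness and regularity. -/

theorem proposition3p1 (E v ϑ : ℝ) (hE : 0 < E) (hv : 0 < v) (hϑ : ϑ ≠ 0)
    (κ : Plane → ℝ) (hκ : IsSmoothBounded κ) (α₁₀ α₂₀ : 𝓢(Plane, ℂ)) :
    ∃ α : ℝ → Plane → Spinor,
      -- `α` is a solution, smooth on `[0, ∞) × ℝ²`
      IsClassCk ∞ (Ici 0) α ∧ SolvesDirac E v ϑ κ α₁₀ α₂₀ (Ici 0) α ∧
      -- it is the only one, even among `C¹` solutions and on every bounded time interval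
      (∀ I : Set ℝ, (I = Ici 0 ∨ ∃ ρ : ℝ, 0 < ρ ∧ I = Icc 0 ρ) →
        ∀ β : ℝ → Plane → Spinor, IsClassCk 1 I β → SolvesDirac E v ϑ κ α₁₀ α₂₀ I β →
          ∀ T ∈ I, ∀ X : Plane, β T X = α T X) ∧
      -- `α ∈ C⁰([0, ρ], H^s) ∩ C¹([0, ρ], H^{s-1})`
      (∀ ρ s : ℝ, 0 < ρ → 2 < s →
        IsSobolevCurve 0 s (Icc 0 ρ) α ∧ IsSobolevCurve 1 (s - 1) (Icc 0 ρ) α) ∧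
      -- every time derivative of every component is a Schwartz function at every time
      (∀ T : ℝ, 0 ≤ T → ∀ (l : ℕ) (j : Fin 2), ∃ g : 𝓢(Plane, ℂ), ∀ X : Plane,
        g X = iteratedDerivWithin l (fun t => α t X j) (Ici 0) T) ∧
      -- weighted bounds, uniform in `T ∈ [0, ρ]`
      (∀ (ρ : ℝ), 0 < ρ → ∀ (l M : ℕ) (n : Fin 2 → ℕ), ∃ C : ℝ, 0 < C ∧
        ∀ T ∈ Icc 0 ρ, ∀ X : Plane,
          (1 + ‖X‖ ^ 2) ^ ((M : ℝ) / 2) *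
            ‖spacePartials n (fun Y => iteratedDerivWithin l (fun t => α t Y) (Ici 0) T) X‖
            ≤ C) := by
  obtain ⟨γ, hγ0, hγ⟩ := exists_solutionCurve pauliOne_isHermitianInvolution
    pauliTwo_isHermitianInvolution (v / (2 * √E)) hκ (massTerm (ϑ / (2 * √E)))
    (initialSpinor α₁₀ α₂₀)
  have hsol := hγ.solvesDirac hκ hγ0
  have hclass : ∀ I, IsClassCk 1 I fun t => γ t := fun I => (hγ.isClassCk I).of_le (by simp)
  refine ⟨fun t => γ t, hγ.isClassCk _, hsol, ?_, fun ρ s _ _ => ⟨hγ.isSobolevCurve zero_le_one s _,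
    hγ.isSobolevCurve le_rfl (s - 1) _⟩, fun T hT l j => ?_, fun ρ _ l M n => hγ.weighted_bound ρ l M n⟩
  · rintro I (rfl | ⟨ρ, hρ, rfl⟩) β hβ hβsol T hT X
    · exact SolvesDirac.unique (fun T _ => Icc_subset_Ici_self) le_rfl hβ (hclass _) hβsol hsol hT X
    · exact SolvesDirac.unique (fun T hT => Icc_subset_Icc_right hT.2) Icc_subset_Ici_self hβ
        (hclass _) hβsol (hsol.mono (hclass _) Icc_subset_Ici_self (uniqueDiffOn_Icc hρ)) hT X
  · let P := (EuclideanSpace.proj j : Spinor →L[ℂ] ℂ).restrictScalars ℝ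
    exact ⟨SchwartzMap.postcompCLM P (((diracGen E v ϑ κ) ^ l) (γ T)),
      fun X => (hγ.iteratedDerivWithin_eq P l hT X).symm⟩
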